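/- **Conventions.** Fix a set of quantum gates (e.g. $\mathrm{CNOT},H,T$). A *circuit* has input wires, ancilla wires initialized to $|0\rangle$, a list of gates, and a set of output wires, the other wires being traced out; its size is the number of gates plus the number of wires. A *QPT distinguisher* is a family $(\mathcal A_\lambda)_{\lambda\in\mathbb N}$ of circuits of size polynomial in $\lambda$ with one output qubit, which is measured; a *non-uniform QPT adversary* additionally receives, for each $\lambda$, a quantum advice state $\alpha_\lambda$ on an arbitrary number of qubits, counted in the circuit size. A function is *negligible* if it is $o(\lambda^{-c})$ for every $c$. A *Haar state* on $n$ qubits is $U|0^n\rangle$ for a Haar random unitary $U$, and a *Haar isometry* from $n$ to $n+m$ qubits is $\mathcal I|\psi\rangle = U|\psi\rangle|0^m\rangle$ for a Haar random unitary $U$ on $n+m$ qubits. Write $\mathscr H_r$ for the distribution of Haar states on $r$ qubits. Let $n=n(\lambda)$ and $m=m(\lambda)$ be polynomially bounded. A family $\{F_\lambda\}_{\lambda\in\mathbb N}$ of polynomial-size circuits is an $(n,n+m)$-*pseudorandom isometry* (PRI) if 1. for every key $k\in\{0,1\}^\lambda$, the channel $F_\lambda(k,\cdot)$ is $\rho\mapsto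 F_k\,\rho\,F_k^\dagger$ for an isometry $F_k$ from $n$ qubits to $n+m$ qubits; and 2. for all polynomially bounded $q=q(\lambda)$, $\ell=\ell(\lambda)$ and every QPT distinguisher $\mathcal A$ there is a negligible $\varepsilon$ such that for all $\lambda$ and all density matrices $\rho$ on $\ell+nq$ qubits, $$\Big|\Pr_{k\leftarrow\{0,1\}^\lambda}\big[\mathcal A_\lambda\big((I_\ell\otimes F_k^{\otimes q})\,\rho\,(I_\ell\otimes F_k^{\otimes q})^\dagger\big)=1\big]-\Pr_{\mathcal I}\big[\mathcal A_\lambda\big((I_\ell\otimes \mathcal I^{\otimes q})\,\rho\,(I_\ell\otimes \mathcal I^{\otimes q})^\dagger\big)=1\big]\Big|\le\varepsilon(\lambda),$$ where $\mathcal I$ is a Haar isometry from $n$ to $n+m$ qubits. **Theorem.** There is a universal constant $C>0$ such that the following holds. Let $\{F_\lambda\}_{\lambda\in\mathbb N}$ be an $(n,n+m)$-PRI, let $t=t(\lambda)\in\mathbb N$, and let $$\rho_\lambda:=\mathop{\mathbb E}_{|\theta\rangle\leftarrow\mathscr H_{2n},\;k\leftarrow\{0,1\}^\lambda}\Big[(I_n\otimes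 F_k)^{\otimes t}\,|\theta\rangle\langle\theta|^{\otimes t}\,(I_n\otimes F_k^\dagger)^{\otimes t}\Big],\qquad \sigma_\lambda:=\mathop{\mathbb E}_{|\gamma\rangle\leftarrow\mathscr H_{2n+m}}\Big[|\gamma\rangle\langle\gamma|^{\otimes t}\Big],$$ where $I_n$ is the identity on the first $n$ qubits of each copy and $F_k$ acts on the last $n$ qubits of each copy. Then for every non-uniform QPT adversary $(\mathcal A_\lambda,\alpha_\lambda)_\lambda$ there is a negligible function $\varepsilon$ such that for all $\lambda$ $$\Big|\Pr\big[\mathcal A_\lambda(\rho_\lambda\otimes\alpha_\lambda)=1\big]-\Pr\big[\mathcal A_\lambda(\sigma_\lambda\otimes\alpha_\lambda)=1\big]\Big|\;\le\; C\left(\frac{t!\,t^2}{2^{n+m}}+\frac{t^2}{2^n}\right)+\varepsilon(\lambda).$$ -/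

import Mathlib

open MeasureTheory
open scoped Matrix ComplexOrder

namespace Pseudorandom

noncomputable section

/-! ### Registers, operators and tensor products

A register of qubits is a finite type `W` of wires. Its computational basis is `W → Bool`, and
operators between registers are complex matrices indexed by basis strings. -/

/-- Linear operators from the register `W'` to the register `W`. -/
abbrev Op (W W' : Type) : Type := Matrix (W → Bool) (W' → Bool) ℂ

/-- Density matrices: positive semidefinite with trace one. -/
def IsDensity {W : Type} [Fintype W] [DecidableEq W] (ρ : Op W W) : Prop :=
  ρ.PosSemidef ∧ ρ.trace = 1

/-- The tensor product `A ⊗ B`; the register `X ⊕ Y` is `X` followed by `Y`. -/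
def tensor {X X' Y Y' : Type} (A : Op X X') (B : Op Y Y') : Op (X ⊕ Y) (X' ⊕ Y') :=
  fun x y => A (fun w => x (Sum.inl w)) (fun w => y (Sum.inl w)) *
    B (fun w => x (Sum.inr w)) (fun w => y (Sum.inr w))

/-- The tensor power `A^{⊗ q}`; wire `(i, w)` is wire `w` of the `i`-th copy. -/
def tensorPower {X X' : Type} (q : ℕ) (A : Op X X') : Op (Fin q × X) (Fin q × X') :=
  fun x y => ∏ i : Fin q, A (fun w => x (i, w)) (fun w => y (i, w))

/-- The rank-one operator `|ψ⟩⟨ψ|`. -/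
def pureState {W : Type} (ψ : (W → Bool) → ℂ) : Op W W :=
  Matrix.vecMulVec ψ (star ψ)

/-- The computational basis state `|x⟩⟨x|`. -/
def basisState {W : Type} [Fintype W] [DecidableEq W] (x : W → Bool) : Op W W :=
  Matrix.single x x 1

/-- The map `ρ ↦ V ρ V†`. -/
def conjBy {W W' : Type} [Fintype W'] [DecidableEq W'] (V : Op W W') (ρ : Op W' W') : Op W W :=
  V * ρ * Vᴴ

/-- The reduced operator on the wires selected by `e`; all the other wires are traced out. -/
def reduce {Out W : Type} [Fintype Out] [DecidableEq Out] [Fintype W] [DecidableEq W]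
    (e : Out ↪ W) (ρ : Op W W) : Op Out Out :=
  fun x y => ∑ z : W → Bool, ∑ z' : W → Bool,
    if (∀ o, z (e o) = x o) ∧ (∀ o, z' (e o) = y o) ∧ (∀ w, (∀ o, e o ≠ w) → z w = z' w)
    then ρ z z' else 0

/-! ### Haar measure -/

section Haar

variable (ι : Type) [Fintype ι] [DecidableEq ι]

instance unitaryMeasurableSpace : MeasurableSpace (Matrix.unitaryGroup ι ℂ) := borel _

instance unitaryBorelSpace : BorelSpace (Matrix.unitaryGroup ι ℂ) := ⟨rfl⟩

instance unitaryCompactSpace : CompactSpace (Matrix.unitaryGroup ι ℂ) := by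
  refine isCompact_iff_compactSpace.mp ?_
  have hbox : IsCompact (Set.pi Set.univ fun _ : ι => Set.pi Set.univ fun _ : ι =>
      Metric.closedBall (0 : ℂ) 1) :=
    isCompact_univ_pi fun _ => isCompact_univ_pi fun _ => isCompact_closedBall _ _
  have hclosed : IsClosed {A : Matrix ι ι ℂ | A ∈ Matrix.unitaryGroup ι ℂ} := by
    simp only [Matrix.mem_unitaryGroup_iff]
    exact isClosed_eq (continuous_id.mul continuous_star) continuous_const
  refine hbox.of_isClosed_subset hclosed ?_
  intro A hA i _ j _
  simpa using entry_norm_bound_of_unitary hA i j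

/-- The Haar probability measure on unitary matrices. -/
def haarUnitary : Measure (Matrix.unitaryGroup ι ℂ) :=
  Measure.haarMeasure (⊤ : TopologicalSpace.PositiveCompacts (Matrix.unitaryGroup ι ℂ))

end Haar

/-- The distribution of a Haar random pure state on the register `W`: the law of `U |0…0⟩` for a
Haar unitary `U`. -/
def haarState (W : Type) [Fintype W] [DecidableEq W] : Measure ((W → Bool) → ℂ) :=
  (haarUnitary (W → Bool)).map
    fun (U : Matrix.unitaryGroup (W → Bool) ℂ) x => (U : Op W W) x fun _ => false

/-- The isometry `|ψ⟩ ↦ U |ψ⟩|0^m⟩` from `n` to `n + m` qubits; it is a Haar isometry when `U` is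
a Haar unitary. -/
def isometryOfUnitary {n m : ℕ} (U : Matrix.unitaryGroup (Fin (n + m) → Bool) ℂ) :
    Op (Fin (n + m)) (Fin n) :=
  fun x y => (U : Op (Fin (n + m)) (Fin (n + m))) x (Fin.append y fun _ => false)

/-! ### Quantum circuits and polynomial-size families -/

/-- A set of elementary quantum gates (for instance `CNOT`, `H`, `T`). -/
structure GateSet where
  Name : Type
  arity : Name → ℕ
  unitary : ∀ g, Matrix.unitaryGroup (Fin (arity g) → Bool) ℂ

/-- A gate together with the distinct wires it acts on. -/
structure PlacedGate (G : GateSet) (W : Type) where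
  gate : G.Name
  wires : Fin (G.arity gate) ↪ W

/-- The operator on the whole register: the gate on its wires, the identity on the others. -/
def PlacedGate.toOp {G : GateSet} {W : Type} [Fintype W] [DecidableEq W]
    (g : PlacedGate G W) : Op W W :=
  fun x y => if ∀ w, (∀ i, g.wires i ≠ w) → x w = y w
    then (G.unitary g.gate : Op (Fin (G.arity g.gate)) (Fin (G.arity g.gate)))
      (fun i => x (g.wires i)) (fun i => y (g.wires i))
    else 0

/-- A generalized quantum circuit: input wires `In`, further `anc` wires initialized to zero, a list
of gates (the head is applied first), and output wires `Out`; the remaining wires are traced out. -/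
structure Circuit (G : GateSet) (In Out : Type) where
  anc : ℕ
  gates : List (PlacedGate G (In ⊕ Fin anc))
  out : Out ↪ In ⊕ Fin anc

namespace Circuit

variable {G : GateSet} {In Out : Type} [Fintype In] [DecidableEq In]

/-- The number of gates plus the number of wires. -/
def size (C : Circuit G In Out) : ℕ := C.gates.length + (Fintype.card In + C.anc)

/-- The unitary part of the circuit. -/
def toOp (C : Circuit G In Out) : Op (In ⊕ Fin C.anc) (In ⊕ Fin C.anc) :=
  C.gates.foldl (fun M g => g.toOp * M) 1

/-- The channel implemented by the circuit. -/
def channel [Fintype Out] [DecidableEq Out] (C : Circuit G In Out) (ρ : Op In In) : Op Out Out :=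
  reduce C.out (conjBy C.toOp (tensor ρ (basisState fun _ : Fin C.anc => false)))

/-- The probability that a circuit with one output qubit outputs `1` on `ρ`. -/
def acceptProb (C : Circuit G In Unit) (ρ : Op In In) : ℝ :=
  (C.channel ρ (fun _ => true) (fun _ => true)).re

end Circuit

/-- `f = poly(κ)`. -/
def PolyBounded (f : ℕ → ℕ) : Prop :=
  ∃ p : Polynomial ℕ, ∀ κ, f κ ≤ p.eval κ

/-- Negligible functions of the security parameter. -/
def Negligible (ε : ℕ → ℝ) : Prop :=
  Asymptotics.SuperpolynomialDecay Filter.atTop (fun κ : ℕ => (κ : ℝ)) ε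

/-- A QPT distinguisher for states on registers `W κ`: a family of circuits of polynomial size with
one output qubit. -/
structure Distinguisher (G : GateSet) (W : ℕ → Type) [∀ κ, Fintype (W κ)]
    [∀ κ, DecidableEq (W κ)] where
  circuit : ∀ κ, Circuit G (W κ) Unit
  polySize : PolyBounded fun κ => (circuit κ).size

/-- A non-uniform QPT distinguisher: a family of circuits of polynomial size with one output qubit,
which moreover receive a quantum advice state that depends only on the security parameter. -/
structure NonuniformDistinguisher (G : GateSet) (W : ℕ → Type) [∀ κ, Fintype (W κ)]
    [∀ κ, DecidableEq (W κ)] where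
  adviceLen : ℕ → ℕ
  advice : ∀ κ, Op (Fin (adviceLen κ)) (Fin (adviceLen κ))
  isDensity_advice : ∀ κ, IsDensity (advice κ)
  circuit : ∀ κ, Circuit G (W κ ⊕ Fin (adviceLen κ)) Unit
  polySize : PolyBounded fun κ => (circuit κ).size

/-- The probability that the distinguisher outputs `1` on `ρ`. -/
def NonuniformDistinguisher.acceptProb {G : GateSet} {W : ℕ → Type} [∀ κ, Fintype (W κ)]
    [∀ κ, DecidableEq (W κ)] (A : NonuniformDistinguisher G W) (κ : ℕ) (ρ : Op (W κ) (W κ)) : ℝ :=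
  (A.circuit κ).acceptProb (tensor ρ (A.advice κ))

/-! ### Pseudorandom isometries -/

/-- The circuits `F κ`, which take a key `k ∈ {0,1}^κ` and an `n`-qubit state, form an
`(n, n+m)`-pseudorandom isometry, and `V κ k` is the isometry implemented under the key `k`. -/
structure IsPRI (G : GateSet) (n m : ℕ → ℕ)
    (F : ∀ κ, Circuit G (Fin κ ⊕ Fin (n κ)) (Fin (n κ + m κ)))
    (V : ∀ κ, (Fin κ → Bool) → Op (Fin (n κ + m κ)) (Fin (n κ))) : Prop where
  polyBounded_n : PolyBounded n
  polyBounded_m : PolyBounded m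
  polySize : PolyBounded fun κ => (F κ).size
  isometry : ∀ κ k, (V κ k)ᴴ * V κ k = 1
  implements : ∀ κ k ρ, (F κ).channel (tensor (basisState k) ρ) = conjBy (V κ k) ρ
  /-- For all polynomials `q, ℓ`, no QPT distinguisher can tell the `q`-fold isometry with a random
  key from the `q`-fold Haar isometry, on any state of `ℓ + n q` qubits. -/
  secure : ∀ q ℓ : ℕ → ℕ, PolyBounded q → PolyBounded ℓ →
    ∀ A : Distinguisher G fun κ => Fin (ℓ κ) ⊕ (Fin (q κ) × Fin (n κ + m κ)),
    ∃ ε : ℕ → ℝ, Negligible ε ∧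
      ∀ (κ : ℕ) (ρ : Op (Fin (ℓ κ) ⊕ (Fin (q κ) × Fin (n κ)))
          (Fin (ℓ κ) ⊕ (Fin (q κ) × Fin (n κ)))), IsDensity ρ →
        |((2 : ℝ) ^ κ)⁻¹ * ∑ k : Fin κ → Bool, (A.circuit κ).acceptProb
            (conjBy (tensor 1 (tensorPower (q κ) (V κ k))) ρ)
          - ∫ U, (A.circuit κ).acceptProb
            (conjBy (tensor 1 (tensorPower (q κ) (isometryOfUnitary U))) ρ)
            ∂haarUnitary (Fin (n κ + m κ) → Bool)| ≤ ε κ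

/-! ### The two mixed states -/

/-- `E_{γ} [ |γ⟩⟨γ|^{⊗ t} ]` for a Haar random state `γ` on the register `W`. -/
def haarCopies (W : Type) [Fintype W] [DecidableEq W] (t : ℕ) : Op (Fin t × W) (Fin t × W) :=
  fun x y => ∫ γ, tensorPower t (pureState γ) x y ∂haarState W

/-- `E_{θ, k} [ (I_n ⊗ V_k)^{⊗ t} |θ⟩⟨θ|^{⊗ t} (I_n ⊗ V_k†)^{⊗ t} ]` for a Haar random state `θ` on
`2n` qubits and a uniformly random key `k ∈ {0,1}^κ`. -/
def extendedCopies {κ n m : ℕ} (t : ℕ) (V : (Fin κ → Bool) → Op (Fin (n + m)) (Fin n)) :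
    Op (Fin t × (Fin n ⊕ Fin (n + m))) (Fin t × (Fin n ⊕ Fin (n + m))) :=
  fun x y => ((2 : ℂ) ^ κ)⁻¹ * ∑ k : Fin κ → Bool, ∫ θ,
    conjBy (tensorPower t (tensor (1 : Op (Fin n) (Fin n)) (V k)))
      (tensorPower t (pureState θ)) x y ∂haarState (Fin n ⊕ Fin n)

end

end Pseudorandom

/-! The proof has a computational half and a statistical half, joined in `distinguisher_bound`.

Computational half: PRI security holds for every input state. The state may therefore consist of the
`t` copies of the `2n`-qubit Haar state together with the advice; the first halves and the advice
form the untouched side register. This replaces the keyed isometry by a Haar isometry at negligible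
cost. The copies are input wires and count towards circuit size, so `t` is polynomially bounded
except when `n = 0`, where the claimed bound is trivial.

Statistical half (`norm_integral_isometry_sub_le`): a Haar isometry is the basis map that appends
zeros followed by a Haar unitary, so the acceptance functional is averaged over unitaries on the
second halves (`twirl`). The copies of the `(2n+m)`-qubit Haar state are invariant under such
unitaries, so both sides are values of the same twirled functional. Call a string of `t` basis
symbols collision-free if its first halves are distinct and its second halves are distinct.
Invariance of Haar measure under diagonal phases and basis permutations shows that on such strings
the moment operator is a constant times the sum of the matrix units `|x⟩⟨x ∘ π|`
(`exists_haarMoment_eq`), with no cross terms to other strings. A basis permutation of the second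
register carries any distinct second halves to any others and is absorbed by the twirl, so its value
on `|x⟩⟨x ∘ π|` depends only on `π` and the first halves. Hence both collision-free parts give the
same average, up to their weights (`map_goodPart`, `norm_map_haarMoment_sub_le`). The missing weight
is a collision probability, bounded by second moments of Haar columns and a union bound
(`integral_weight_mul`, `one_sub_goodWeight_le`). This yields `16 t² / 2^n`. -/

namespace Pseudorandom

/-! ### Tensor products of operators -/

section TensorAlgebra

variable {X X' X'' Y Y' Y'' : Type}

theorem tensor_mul [Fintype X'] [DecidableEq X'] [Fintype Y'] [DecidableEq Y']
    (A : Op X X') (B : Op Y Y') (A' : Op X' X'') (B' : Op Y' Y'') :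
    tensor A B * tensor A' B' = tensor (A * A') (B * B') := by
  ext x y
  simp only [Matrix.mul_apply, tensor, Finset.sum_mul_sum]
  rw [← Fintype.sum_prod_type']
  refine Fintype.sum_equiv (Equiv.sumArrowEquivProdArrow X' Y' Bool) _ _ fun z => ?_
  simp only [Equiv.sumArrowEquivProdArrow, Equiv.coe_fn_mk, Function.comp_def]
  ring

theorem conjTranspose_tensor (A : Op X X') (B : Op Y Y') :
    (tensor A B)ᴴ = tensor Aᴴ Bᴴ := by
  ext x y
  simp [tensor, Matrix.conjTranspose_apply]

theorem tensorPower_mul [Fintype X'] [DecidableEq X'] (q : ℕ) (A : Op X X') (B : Op X' X'') :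
    tensorPower q A * tensorPower q B = tensorPower q (A * B) := by
  ext x y
  simp only [Matrix.mul_apply, tensorPower, ← Finset.prod_mul_distrib]
  rw [Fintype.prod_sum]
  exact Fintype.sum_equiv (Equiv.curry (Fin q) X' Bool) _ _ fun z => rfl

theorem conjTranspose_tensorPower (q : ℕ) (A : Op X X') :
    (tensorPower q A)ᴴ = tensorPower q Aᴴ := by
  ext x y
  simp [tensorPower, Matrix.conjTranspose_apply]

theorem tensor_one [DecidableEq X] [DecidableEq Y] [Fintype X] [Fintype Y] :
    tensor (1 : Op X X) (1 : Op Y Y) = 1 := by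
  ext x y
  simp only [tensor, Matrix.one_apply, ← ite_and, mul_ite, mul_one, mul_zero]
  congr 1
  simp only [funext_iff, Sum.forall, eq_iff_iff]
  tauto

theorem prod_ite_one_zero {ι : Type*} [Fintype ι] (p : ι → Prop) [DecidablePred p]
    [Decidable (∀ i, p i)] :
    ∏ i, (if p i then (1 : ℂ) else 0) = if ∀ i, p i then 1 else 0 := by
  rw [Finset.prod_ite_zero]
  simp

theorem tensorPower_one [DecidableEq X] [Fintype X] (q : ℕ) :
    tensorPower q (1 : Op X X) = 1 := by
  ext x y
  simp only [tensorPower, Matrix.one_apply, prod_ite_one_zero]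
  congr 1
  simp only [funext_iff, Prod.forall]

theorem trace_tensor [Fintype X] [DecidableEq X] [Fintype Y] [DecidableEq Y]
    (A : Op X X) (B : Op Y Y) : (tensor A B).trace = A.trace * B.trace := by
  simp only [Matrix.trace, Matrix.diag, tensor, Finset.sum_mul_sum]
  rw [← Fintype.sum_prod_type']
  exact Fintype.sum_equiv (Equiv.sumArrowEquivProdArrow X Y Bool) _ _ fun z => rfl

theorem tensor_eq_submatrix (A : Op X X') (B : Op Y Y') :
    tensor A B = (Matrix.kroneckerMap (· * ·) A B).submatrix
      (Equiv.sumArrowEquivProdArrow X Y Bool) (Equiv.sumArrowEquivProdArrow X' Y' Bool) := rfl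

theorem posSemidef_tensor [Fintype X] [DecidableEq X] [Fintype Y] [DecidableEq Y]
    {A : Op X X} {B : Op Y Y} (hA : A.PosSemidef) (hB : B.PosSemidef) :
    (tensor A B).PosSemidef := by
  rw [tensor_eq_submatrix]
  exact (hA.kronecker hB).submatrix _

theorem IsDensity.tensor [Fintype X] [DecidableEq X] [Fintype Y] [DecidableEq Y]
    {A : Op X X} {B : Op Y Y} (hA : IsDensity A) (hB : IsDensity B) :
    IsDensity (Pseudorandom.tensor A B) :=
  ⟨posSemidef_tensor hA.1 hB.1, by rw [trace_tensor, hA.2, hB.2, one_mul]⟩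

theorem isDensity_basisState [Fintype X] [DecidableEq X] (x : X → Bool) :
    IsDensity (basisState x) := by
  refine ⟨?_, by simp [basisState, Matrix.trace_single_eq_same]⟩
  have h : basisState x = Matrix.diagonal (Pi.single x (1 : ℂ)) := by
    simp [basisState, Matrix.diagonal_single]
  rw [h]
  refine Matrix.PosSemidef.diagonal fun i => ?_
  by_cases hi : i = x <;> simp [hi]

/-- Tensoring with a fixed operator on the right, as a linear map. -/
def tensorRight (B : Op Y Y') : Op X X' →ₗ[ℂ] Op (X ⊕ Y) (X' ⊕ Y') where
  toFun A := tensor A B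
  map_add' A A' := by ext; simp [tensor, add_mul]
  map_smul' c A := by ext; simp [tensor, mul_assoc]

/-- Conjugation, as a linear map. -/
def conjByₗ [Fintype X'] [DecidableEq X'] (V : Op X X') : Op X' X' →ₗ[ℂ] Op X X where
  toFun ρ := conjBy V ρ
  map_add' A A' := by simp [conjBy, Matrix.mul_add, Matrix.add_mul]
  map_smul' c A := by simp [conjBy]

theorem conjBy_conjBy [Fintype X'] [DecidableEq X'] [Fintype X''] [DecidableEq X'']
    (V : Op X X') (W : Op X' X'') (ρ : Op X'' X'') :
    conjBy V (conjBy W ρ) = conjBy (V * W) ρ := by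
  simp [conjBy, Matrix.conjTranspose_mul, Matrix.mul_assoc]

theorem tensor_conjBy [Fintype X'] [DecidableEq X'] [Fintype Y'] [DecidableEq Y']
    (V : Op X X') (W : Op Y Y') (A : Op X' X') (B : Op Y' Y') :
    conjBy (tensor V W) (tensor A B) = tensor (conjBy V A) (conjBy W B) := by
  simp [conjBy, conjTranspose_tensor, tensor_mul]

theorem conjBy_one [Fintype X] [DecidableEq X] (A : Op X X) : conjBy 1 A = A := by
  simp [conjBy]

theorem posSemidef_conjBy [Fintype X] [Fintype X'] [DecidableEq X'] [DecidableEq X]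
    (V : Op X X') {A : Op X' X'} (hA : A.PosSemidef) : (conjBy V A).PosSemidef :=
  hA.mul_mul_conjTranspose_same V

theorem trace_conjBy [Fintype X] [DecidableEq X] [Fintype X'] [DecidableEq X']
    {V : Op X X'} (hV : Vᴴ * V = 1) (A : Op X' X') : (conjBy V A).trace = A.trace := by
  rw [conjBy, Matrix.trace_mul_cycle, hV, one_mul]

theorem IsDensity.conjBy [Fintype X] [DecidableEq X] [Fintype X'] [DecidableEq X']
    {V : Op X X'} (hV : Vᴴ * V = 1) {A : Op X' X'} (hA : IsDensity A) :
    IsDensity (Pseudorandom.conjBy V A) :=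
  ⟨posSemidef_conjBy V hA.1, by rw [trace_conjBy hV, hA.2]⟩

theorem isometry_tensor_one [Fintype X] [DecidableEq X] [Fintype Y] [DecidableEq Y]
    [Fintype Y'] [DecidableEq Y'] {V : Op Y Y'} (hV : Vᴴ * V = 1) :
    (tensor (1 : Op X X) V)ᴴ * tensor (1 : Op X X) V = 1 := by
  rw [conjTranspose_tensor, tensor_mul, hV]
  simp [tensor_one]

theorem isometry_tensorPower [Fintype X] [DecidableEq X] [Fintype X'] [DecidableEq X']
    (q : ℕ) {V : Op X X'} (hV : Vᴴ * V = 1) :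
    (tensorPower q V)ᴴ * tensorPower q V = 1 := by
  rw [conjTranspose_tensorPower, tensorPower_mul, hV, tensorPower_one]

end TensorAlgebra

/-! ### Maps of basis states -/

section BasisMap

/-- The linear map sending the basis vector `i` to the basis vector `g i`. -/
def basisMap {I J : Type*} [DecidableEq J] (g : I → J) : Matrix J I ℂ :=
  fun j i => if j = g i then 1 else 0

theorem basisMap_conj_single {I J : Type*} [Fintype I] [DecidableEq I] [DecidableEq J]
    (g : I → J) (x y : I) :
    basisMap g * Matrix.single x y (1 : ℂ) * (basisMap g)ᴴ = Matrix.single (g x) (g y) 1 := by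
  ext a b
  simp only [Matrix.mul_apply, basisMap, Matrix.single_apply, Matrix.conjTranspose_apply]
  rw [Finset.sum_eq_single y, Finset.sum_eq_single x]
  · by_cases h1 : a = g x <;> by_cases h2 : b = g y <;> simp [h1, h2, eq_comm]
  · intro z _ hz
    simp [hz.symm]
  · simp
  · intro z _ hz
    simp [hz.symm]
  · simp

theorem basisMap_isometry {I J : Type*} [Fintype J] [DecidableEq I] [DecidableEq J]
    {g : I → J} (hg : Function.Injective g) : (basisMap g)ᴴ * basisMap g = 1 := by
  ext a b
  simp [Matrix.mul_apply, basisMap, Matrix.one_apply, hg.eq_iff, eq_comm]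

variable {X X' Y Y' : Type}

theorem tensor_basisMap [DecidableEq X] [Fintype X] [DecidableEq Y] [Fintype Y]
    (g : (X' → Bool) → X → Bool) (h : (Y' → Bool) → Y → Bool) :
    tensor (basisMap g) (basisMap h)
      = basisMap fun x => Sum.elim (g fun w => x (Sum.inl w)) (h fun w => x (Sum.inr w)) := by
  ext x y
  simp only [tensor, basisMap, ← ite_and, mul_ite, mul_one, mul_zero]
  congr 1
  simp only [funext_iff, Sum.forall, eq_iff_iff, Sum.elim_inl, Sum.elim_inr]
  tauto

theorem one_eq_basisMap [DecidableEq X] [Fintype X] : (1 : Op X X) = basisMap id := by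
  ext x y
  simp [basisMap, Matrix.one_apply]

theorem tensorPower_basisMap [DecidableEq X] [Fintype X] (q : ℕ)
    (g : (X' → Bool) → X → Bool) :
    tensorPower q (basisMap g) = basisMap fun x p => g (fun w => x (p.1, w)) p.2 := by
  ext x y
  simp only [tensorPower, basisMap, prod_ite_one_zero]
  congr 1
  simp only [funext_iff, Prod.forall]

end BasisMap

/-! ### Relabelling of wires -/

section Relabel

/-- Relabel the wires of an operator along a bijection of registers. -/
def relabelOp {W W' V V' : Type} (e : W ≃ W') (f : V ≃ V') (A : Op W V) : Op W' V' :=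
  A.submatrix (fun x => x ∘ e) (fun y => y ∘ f)

variable {W W' V V' X X' : Type}

theorem relabelOp_eq_submatrix (e : W ≃ W') (f : V ≃ V') (A : Op W V) :
    relabelOp e f A
      = A.submatrix (e.arrowCongr (Equiv.refl Bool)).symm (f.arrowCongr (Equiv.refl Bool)).symm :=
  rfl

theorem relabelOp_mul [Fintype V] [DecidableEq V] [Fintype V'] [DecidableEq V']
    (e : W ≃ W') (f : V ≃ V') (g : X ≃ X') (A : Op W V) (B : Op V X) :
    relabelOp e f A * relabelOp f g B = relabelOp e g (A * B) := by
  simp only [relabelOp_eq_submatrix]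
  exact Matrix.submatrix_mul_equiv A B _ _ _

theorem conjTranspose_relabelOp (e : W ≃ W') (f : V ≃ V') (A : Op W V) :
    (relabelOp e f A)ᴴ = relabelOp f e Aᴴ := rfl

theorem relabelOp_one [Fintype W] [DecidableEq W] [Fintype W'] [DecidableEq W'] (e : W ≃ W') :
    relabelOp e e (1 : Op W W) = 1 := by
  rw [relabelOp_eq_submatrix]
  exact Matrix.submatrix_one_equiv _

theorem conjBy_relabelOp [Fintype V] [DecidableEq V] [Fintype V'] [DecidableEq V']
    (e : W ≃ W') (f : V ≃ V') (A : Op W V) (ρ : Op V V) :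
    conjBy (relabelOp e f A) (relabelOp f f ρ) = relabelOp e e (conjBy A ρ) := by
  simp [conjBy, conjTranspose_relabelOp, relabelOp_mul]

theorem IsDensity.relabelOp [Fintype W] [DecidableEq W] [Fintype W'] [DecidableEq W']
    (e : W ≃ W') {ρ : Op W W} (h : IsDensity ρ) :
    IsDensity (Pseudorandom.relabelOp e e ρ) := by
  rw [relabelOp_eq_submatrix]
  refine ⟨h.1.submatrix _, ?_⟩
  rw [← h.2]
  exact Fintype.sum_equiv (e.arrowCongr (Equiv.refl Bool)).symm _ _ fun x => rfl

end Relabel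

/-! ### Circuits as contractions -/

section Gates

variable {G : GateSet} {W W' : Type} [Fintype W] [DecidableEq W] [Fintype W'] [DecidableEq W']

/-- Splitting the register into the wires of the gate and the remaining ones turns the operator into
a Kronecker product of a unitary with the identity. -/
theorem PlacedGate.isometry_toOp (g : PlacedGate G W) : g.toOpᴴ * g.toOp = 1 := by
  classical
  let e : Fin (G.arity g.gate) ⊕ ((Set.range g.wires)ᶜ : Set W) ≃ W :=
    ((Equiv.ofInjective g.wires g.wires.injective).sumCongr (Equiv.refl _)).trans
      (Equiv.Set.sumCompl (Set.range g.wires))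
  let φ : (W → Bool) ≃ (Fin (G.arity g.gate) → Bool) × (((Set.range g.wires)ᶜ : Set W) → Bool) :=
    (e.arrowCongr (Equiv.refl Bool)).symm.trans (Equiv.sumArrowEquivProdArrow _ _ _)
  have h : g.toOp = (Matrix.kroneckerMap (· * ·)
      (G.unitary g.gate : Op (Fin (G.arity g.gate)) (Fin (G.arity g.gate)))
      (1 : Matrix (((Set.range g.wires)ᶜ : Set W) → Bool)
        (((Set.range g.wires)ᶜ : Set W) → Bool) ℂ)).submatrix φ φ := by
    ext x y
    have h1 : ∀ z : W → Bool, φ z = (fun i => z (g.wires i), fun w => z w.1) := fun z => rfl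
    simp only [PlacedGate.toOp, Matrix.submatrix_apply, Matrix.kroneckerMap_apply, h1,
      Matrix.one_apply, mul_ite, mul_one, mul_zero]
    congr 1
    simp only [funext_iff, Subtype.forall, Set.mem_compl_iff, Set.mem_range, not_exists]
  have hU := Matrix.UnitaryGroup.star_mul_self (G.unitary g.gate)
  rw [Matrix.star_eq_conjTranspose] at hU
  rw [h, Matrix.conjTranspose_submatrix, Matrix.submatrix_mul_equiv]
  have h2 := Matrix.conjTranspose_kronecker
    (G.unitary g.gate : Op (Fin (G.arity g.gate)) (Fin (G.arity g.gate)))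
    (1 : Matrix (((Set.range g.wires)ᶜ : Set W) → Bool) (((Set.range g.wires)ᶜ : Set W) → Bool) ℂ)
  rw [h2, ← Matrix.mul_kronecker_mul, hU]
  simp

/-- Relabel the wires of a gate. -/
def PlacedGate.map (e : W ≃ W') (g : PlacedGate G W) : PlacedGate G W' :=
  ⟨g.gate, g.wires.trans e.toEmbedding⟩

theorem PlacedGate.toOp_map (e : W ≃ W') (g : PlacedGate G W) :
    (g.map e).toOp = relabelOp e e g.toOp := by
  ext x y
  simp only [PlacedGate.toOp, PlacedGate.map, relabelOp, Matrix.submatrix_apply,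
    Function.comp_apply]
  congr 1
  refine propext ((e.forall_congr_right).symm.trans (forall_congr' fun w => ?_))
  refine imp_congr (forall_congr' fun i => not_congr ?_) Iff.rfl
  exact e.apply_eq_iff_eq

end Gates

namespace Circuit

variable {G : GateSet} {In In' Out : Type} [Fintype In] [DecidableEq In]
  [Fintype In'] [DecidableEq In']

theorem isometry_foldl (l : List (PlacedGate G In)) (M : Op In In) (hM : Mᴴ * M = 1) :
    (l.foldl (fun M g => g.toOp * M) M)ᴴ * l.foldl (fun M g => g.toOp * M) M = 1 := by
  induction l generalizing M with
  | nil => simpa using hM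
  | cons g l ih =>
    refine ih _ ?_
    rw [Matrix.conjTranspose_mul, Matrix.mul_assoc, ← Matrix.mul_assoc g.toOpᴴ,
      g.isometry_toOp, one_mul, hM]

theorem isometry_toOp (C : Circuit G In Out) : C.toOpᴴ * C.toOp = 1 :=
  isometry_foldl _ _ (by simp)

/-- The operator on all wires after the gates have been applied. -/
def finalₗ (C : Circuit G In Out) : Op In In →ₗ[ℂ] Op (In ⊕ Fin C.anc) (In ⊕ Fin C.anc) :=
  conjByₗ C.toOp ∘ₗ tensorRight (basisState fun _ : Fin C.anc => false)

theorem finalₗ_apply (C : Circuit G In Out) (ρ : Op In In) :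
    C.finalₗ ρ = conjBy C.toOp (tensor ρ (basisState fun _ : Fin C.anc => false)) := rfl

/-- The acceptance probability, as a complex linear functional. -/
def acceptₗ (C : Circuit G In Unit) : Op In In →ₗ[ℂ] ℂ :=
  (∑ z : In ⊕ Fin C.anc → Bool, if z (C.out ()) = true then
    (Matrix.entryLinearMap ℂ ℂ z z) else 0) ∘ₗ C.finalₗ

theorem acceptₗ_apply (C : Circuit G In Unit) (ρ : Op In In) :
    C.acceptₗ ρ = ∑ z : In ⊕ Fin C.anc → Bool,
      if z (C.out ()) = true then C.finalₗ ρ z z else 0 := by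
  rw [acceptₗ, LinearMap.comp_apply, LinearMap.sum_apply]
  refine Finset.sum_congr rfl fun z _ => ?_
  split_ifs <;> simp

/-- Tracing out all wires but the output, whose two indices are both `true`, forces `z = z'`, so
only diagonal entries survive. -/
theorem acceptProb_eq (C : Circuit G In Unit) (ρ : Op In In) :
    C.acceptProb ρ = (C.acceptₗ ρ).re := by
  rw [acceptProb, acceptₗ_apply, channel, reduce]
  congr 1
  refine Finset.sum_congr rfl fun z _ => ?_
  rw [Finset.sum_eq_single z]
  · rw [finalₗ_apply]
    refine if_congr ?_ rfl rfl
    exact ⟨fun h => h.1 (), fun h => ⟨fun _ => h, fun _ => h, fun _ _ => rfl⟩⟩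
  · intro z' _ hne
    rw [if_neg]
    rintro ⟨h1, h2, h3⟩
    apply hne
    funext w
    by_cases hw : C.out () = w
    · rw [← hw, h1 (), h2 ()]
    · exact (h3 w fun _ => hw).symm
  · simp

/-- Acceptance sums some of the diagonal entries of a positive semidefinite operator with the trace
of `ρ`. Positivity and trace are all that the statistical half uses about a distinguisher. -/
theorem norm_acceptₗ_le (C : Circuit G In Unit) {ρ : Op In In} (hρ : ρ.PosSemidef) :
    ‖C.acceptₗ ρ‖ ≤ ρ.trace.re := by
  have hpsd : (C.finalₗ ρ).PosSemidef :=
    posSemidef_conjBy _ (posSemidef_tensor hρ (isDensity_basisState _).1)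
  have htr : (C.finalₗ ρ).trace = ρ.trace := by
    rw [finalₗ_apply, trace_conjBy C.isometry_toOp, trace_tensor, (isDensity_basisState _).2,
      mul_one]
  rw [acceptₗ_apply, ← htr, Matrix.trace, Complex.re_sum]
  refine (norm_sum_le _ _).trans (Finset.sum_le_sum fun z _ => ?_)
  have hz := hpsd.diag_nonneg (i := z)
  have hz' := Complex.nonneg_iff.mp hz
  split_ifs
  · exact (Complex.re_eq_norm.mpr hz).ge
  · simpa using hz'.1

/-- Relabel the input wires of a circuit. -/
def relabel (e : In ≃ In') (C : Circuit G In Out) : Circuit G In' Out where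
  anc := C.anc
  gates := C.gates.map (PlacedGate.map (e.sumCongr (Equiv.refl _)))
  out := C.out.trans (e.sumCongr (Equiv.refl _)).toEmbedding

omit [DecidableEq In] [DecidableEq In'] in
theorem size_relabel (e : In ≃ In') (C : Circuit G In Out) : (C.relabel e).size = C.size := by
  simp [size, relabel, Fintype.card_congr e]

theorem toOp_relabel (e : In ≃ In') (C : Circuit G In Out) :
    (C.relabel e).toOp = relabelOp (e.sumCongr (Equiv.refl (Fin C.anc)))
      (e.sumCongr (Equiv.refl (Fin C.anc))) C.toOp := by
  let f := e.sumCongr (Equiv.refl (Fin C.anc))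
  have key : ∀ (l : List (PlacedGate G (In ⊕ Fin C.anc)))
      (M : Op (In ⊕ Fin C.anc) (In ⊕ Fin C.anc)),
      (l.map (PlacedGate.map f)).foldl (fun M g => g.toOp * M) (relabelOp f f M)
      = relabelOp f f (l.foldl (fun M g => g.toOp * M) M) := by
    intro l
    induction l with
    | nil => intro M; rfl
    | cons g l ih =>
      intro M
      simp only [List.map_cons, List.foldl_cons, PlacedGate.toOp_map, relabelOp_mul, ih]
  have h := key C.gates 1
  rw [relabelOp_one] at h
  exact h

theorem acceptₗ_relabel (e : In ≃ In') (C : Circuit G In Unit) (ρ : Op In In) :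
    (C.relabel e).acceptₗ (relabelOp e e ρ) = C.acceptₗ ρ := by
  rw [acceptₗ_apply, acceptₗ_apply]
  let f := e.sumCongr (Equiv.refl (Fin C.anc))
  refine Fintype.sum_equiv (f.arrowCongr (Equiv.refl Bool)).symm _ _ fun z => ?_
  have h : (C.relabel e).finalₗ (relabelOp e e ρ) = relabelOp f f (C.finalₗ ρ) := by
    refine Eq.trans ?_ (conjBy_relabelOp f f C.toOp
      (tensor ρ (basisState fun _ : Fin C.anc => false)))
    rw [finalₗ_apply, toOp_relabel]
    rfl
  rw [h]
  rfl

end Circuit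

/-! ### Expectations over Haar random unitaries -/

section HaarUnitary

variable (ι : Type) [Fintype ι] [DecidableEq ι]

instance isHaarMeasure_haarUnitary : (haarUnitary ι).IsHaarMeasure := by
  unfold haarUnitary
  infer_instance

instance isProbabilityMeasure_haarUnitary : IsProbabilityMeasure (haarUnitary ι) := by
  refine ⟨?_⟩
  have h := Measure.haarMeasure_self
    (K₀ := (⊤ : TopologicalSpace.PositiveCompacts (Matrix.unitaryGroup ι ℂ)))
  simpa [haarUnitary] using h

/-- A right translate of Haar measure is again a left-invariant probability measure, hence equal to
it by uniqueness. Right invariance lets `twirl` absorb unitaries. -/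
instance isMulRightInvariant_haarUnitary : (haarUnitary ι).IsMulRightInvariant := by
  refine ⟨fun g => ?_⟩
  have : IsProbabilityMeasure ((haarUnitary ι).map (· * g)) :=
    Measure.isProbabilityMeasure_map (continuous_mul_const g).measurable.aemeasurable
  exact Measure.isHaarMeasure_eq_of_isProbabilityMeasure _ _

variable {ι}

theorem integrable_haarUnitary {f : Matrix.unitaryGroup ι ℂ → ℂ} (hf : Continuous f) :
    Integrable f (haarUnitary ι) :=
  hf.integrable_of_hasCompactSupport (HasCompactSupport.of_compactSpace f)

theorem continuous_unitary_entry (i j : ι) :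
    Continuous fun U : Matrix.unitaryGroup ι ℂ => (U : Matrix ι ι ℂ) i j :=
  (continuous_apply_apply i j).comp continuous_subtype_val

/-- Mixed states are defined by entrywise integrals; expanding in matrix units reduces the exchange
with `L` to a finite sum. -/
theorem linearMap_integral {Ω I J : Type*} [MeasurableSpace Ω] {μ : Measure Ω} [Fintype I]
    [Fintype J] [DecidableEq I] [DecidableEq J] (L : Matrix I J ℂ →ₗ[ℂ] ℂ) (f : Ω → Matrix I J ℂ)
    (hf : ∀ x y, Integrable (fun ω => f ω x y) μ) :
    L (fun x y => ∫ ω, f ω x y ∂μ) = ∫ ω, L (f ω) ∂μ := by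
  have h : ∀ M : Matrix I J ℂ, L M = ∑ x, ∑ y, M x y * L (Matrix.single x y 1) := by
    intro M
    conv_lhs => rw [Matrix.matrix_eq_sum_single M]
    simp only [map_sum]
    refine Finset.sum_congr rfl fun x _ => Finset.sum_congr rfl fun y _ => ?_
    rw [← smul_eq_mul, ← map_smul, Matrix.smul_single, smul_eq_mul, mul_one]
  refine (h _).trans ?_
  rw [show (fun ω => L (f ω)) = _ from funext fun ω => h (f ω)]
  rw [integral_finsetSum _ fun x _ => integrable_finsetSum _ fun y _ => (hf x y).mul_const _]
  refine Finset.sum_congr rfl fun x _ => ?_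
  rw [integral_finsetSum _ fun y _ => (hf x y).mul_const _]
  refine Finset.sum_congr rfl fun y _ => ?_
  rw [integral_mul_const]

theorem integral_nonneg_complex {Ω : Type*} [MeasurableSpace Ω] {μ : Measure Ω} {f : Ω → ℂ}
    (hf : ∀ ω, 0 ≤ f ω) : 0 ≤ ∫ ω, f ω ∂μ := by
  have h : f = fun ω => ((f ω).re : ℂ) := by
    funext ω
    exact Complex.eq_re_of_ofReal_le (r := 0) (by simpa using hf ω)
  rw [h, integral_complex_ofReal]
  exact_mod_cast integral_nonneg fun ω => (Complex.nonneg_iff.mp (hf ω)).1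

theorem posSemidef_integral {Ω I : Type*} [MeasurableSpace Ω] {μ : Measure Ω} [Fintype I]
    [DecidableEq I] (f : Ω → Matrix I I ℂ) (hf : ∀ x y, Integrable (fun ω => f ω x y) μ)
    (hpos : ∀ ω, (f ω).PosSemidef) :
    Matrix.PosSemidef (fun x y => ∫ ω, f ω x y ∂μ : Matrix I I ℂ) := by
  refine Matrix.PosSemidef.of_dotProduct_mulVec_nonneg ?_ fun v => ?_
  · refine Matrix.IsHermitian.ext fun x y => ?_
    change (starRingEnd ℂ) (∫ ω, f ω y x ∂μ) = ∫ ω, f ω x y ∂μ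
    rw [← integral_conj]
    exact integral_congr_ae (.of_forall fun ω => (hpos ω).1.apply x y)
  · let L : Matrix I I ℂ →ₗ[ℂ] ℂ :=
      { toFun := fun M => star v ⬝ᵥ M *ᵥ v
        map_add' := fun M N => by rw [Matrix.add_mulVec, dotProduct_add]
        map_smul' := fun c M => by rw [Matrix.smul_mulVec, dotProduct_smul]; rfl }
    have h := linearMap_integral (μ := μ) L f hf
    change 0 ≤ L (fun x y => ∫ ω, f ω x y ∂μ)
    rw [h]
    exact integral_nonneg_complex fun ω => (hpos ω).dotProduct_mulVec_nonneg v

/-- The moments `E [∏ᵢ θ(xᵢ) θ(yᵢ)*]` of the column `o` of a Haar unitary. -/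
noncomputable def haarMoment (o : ι) (t : ℕ) : Matrix (Fin t → ι) (Fin t → ι) ℂ :=
  fun x y => ∫ U : Matrix.unitaryGroup ι ℂ,
    ∏ i, ((U : Matrix ι ι ℂ) (x i) o * star ((U : Matrix ι ι ℂ) (y i) o)) ∂haarUnitary ι

variable {o : ι} {t : ℕ}

theorem continuous_moment (o : ι) {t : ℕ} (x y : Fin t → ι) :
    Continuous fun U : Matrix.unitaryGroup ι ℂ =>
      ∏ i, ((U : Matrix ι ι ℂ) (x i) o * star ((U : Matrix ι ι ℂ) (y i) o)) :=
  continuous_finsetProd _ fun _ _ =>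
    (continuous_unitary_entry _ _).mul (continuous_unitary_entry _ _).star

theorem sum_normSq_col (U : Matrix.unitaryGroup ι ℂ) (o : ι) :
    ∑ i, (U : Matrix ι ι ℂ) i o * star ((U : Matrix ι ι ℂ) i o) = 1 := by
  have h := congrFun (congrFun (Matrix.UnitaryGroup.star_mul_self U) o) o
  simp only [Matrix.mul_apply, Matrix.star_apply, Matrix.one_apply_eq] at h
  rw [← h]
  exact Finset.sum_congr rfl fun i _ => mul_comm _ _

theorem trace_haarMoment : (haarMoment o t).trace = 1 := by
  simp only [Matrix.trace, Matrix.diag, haarMoment]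
  rw [← integral_finsetSum _ fun x _ => integrable_haarUnitary (continuous_moment o x x)]
  have h : ∀ U : Matrix.unitaryGroup ι ℂ, ∑ x : Fin t → ι,
      ∏ i, ((U : Matrix ι ι ℂ) (x i) o * star ((U : Matrix ι ι ℂ) (x i) o)) = 1 := by
    intro U
    rw [← Fintype.prod_sum fun (_ : Fin t) j =>
      (U : Matrix ι ι ℂ) j o * star ((U : Matrix ι ι ℂ) j o)]
    simp only [sum_normSq_col, Finset.prod_const_one]
  simp only [h, integral_const, probReal_univ, one_smul]

theorem posSemidef_haarMoment : (haarMoment o t).PosSemidef := by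
  let f : Matrix.unitaryGroup ι ℂ → Matrix (Fin t → ι) (Fin t → ι) ℂ := fun U x y =>
    ∏ i, ((U : Matrix ι ι ℂ) (x i) o * star ((U : Matrix ι ι ℂ) (y i) o))
  have hf : ∀ U, (f U).PosSemidef := by
    intro U
    have h := Matrix.posSemidef_vecMulVec_self_star
      (fun x : Fin t → ι => ∏ i, (U : Matrix ι ι ℂ) (x i) o)
    convert h using 1
    ext x y
    simp [f, Matrix.vecMulVec_apply, Finset.prod_mul_distrib]
  exact posSemidef_integral f (fun x y => integrable_haarUnitary (continuous_moment o x y)) hf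

theorem integral_unitary_mul (W : Matrix.unitaryGroup ι ℂ) (f : Matrix.unitaryGroup ι ℂ → ℂ) :
    ∫ U, f (W * U) ∂haarUnitary ι = ∫ U, f U ∂haarUnitary ι :=
  integral_mul_left_eq_self f W

/-- The unitary permuting the basis vectors. -/
def permUnitary (τ : Equiv.Perm ι) : Matrix.unitaryGroup ι ℂ :=
  ⟨basisMap τ, Matrix.mem_unitaryGroup_iff'.mpr (basisMap_isometry τ.injective)⟩

theorem basisMap_mul_apply {κ : Type*} (τ : Equiv.Perm ι) (M : Matrix ι κ ℂ) (i : ι) (j : κ) :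
    (basisMap τ * M) (τ i) j = M i j := by
  simp [Matrix.mul_apply, basisMap, Finset.sum_ite_eq]

theorem haarMoment_perm (τ : Equiv.Perm ι) (x y : Fin t → ι) :
    haarMoment o t (τ ∘ x) (τ ∘ y) = haarMoment o t x y := by
  rw [haarMoment, ← integral_unitary_mul (permUnitary τ)]
  simp [permUnitary, basisMap_mul_apply, haarMoment]

/-- The diagonal unitary with the given phases. -/
noncomputable def phaseUnitary (φ : ι → Circle) : Matrix.unitaryGroup ι ℂ :=
  ⟨Matrix.diagonal fun i => (φ i : ℂ), by
    rw [Matrix.mem_unitaryGroup_iff, Matrix.star_eq_conjTranspose, Matrix.diagonal_conjTranspose,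
      Matrix.diagonal_mul_diagonal]
    have h : ∀ i, (φ i : ℂ) * star (fun i => (φ i : ℂ)) i = 1 := fun i => by
      simp [Complex.mul_conj]
    simp only [h, Matrix.diagonal_one]⟩

theorem haarMoment_phase (φ : ι → Circle) (x y : Fin t → ι) :
    haarMoment o t x y
      = (∏ i, ((φ (x i) : ℂ) * star (φ (y i) : ℂ))) * haarMoment o t x y := by
  conv_lhs => rw [haarMoment, ← integral_unitary_mul (phaseUnitary φ)]
  rw [haarMoment, ← integral_const_mul]
  refine integral_congr_ae (.of_forall fun U => ?_)
  simp only [phaseUnitary, Submonoid.coe_mul, Matrix.diagonal_mul, star_mul',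
    ← Finset.prod_mul_distrib]
  exact Finset.prod_congr rfl fun i _ => by ring

end HaarUnitary

/-! ### Structure of the moments of a Haar random state -/

section Structure

/-- The bijection between the two ranges extends to a permutation of the finite alphabet. -/
theorem exists_perm_comp_eq {ι : Type*} [Fintype ι] [DecidableEq ι] {t : ℕ} {x y : Fin t → ι}
    (hx : Function.Injective x) (hy : Function.Injective y) :
    ∃ τ : Equiv.Perm ι, τ ∘ x = y := by
  classical
  let e : {a // a ∈ Set.range x} ≃ {a // a ∈ Set.range y} :=
    (Equiv.ofInjective x hx).symm.trans (Equiv.ofInjective y hy)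
  refine ⟨e.extendSubtype, funext fun i => ?_⟩
  rw [Function.comp_apply, Equiv.extendSubtype_apply_of_mem e (x i) ⟨i, rfl⟩]
  have h : (Equiv.ofInjective x hx).symm ⟨x i, ⟨i, rfl⟩⟩ = i :=
    Equiv.ofInjective_symm_apply hx i
  simp only [e, Equiv.trans_apply, h, Equiv.ofInjective_apply]

/-- Bijections between fibres of equal size glue to a permutation of the positions. -/
theorem exists_comp_perm_eq {ι : Type*} [DecidableEq ι] {t : ℕ} {x y : Fin t → ι}
    (h : ∀ k, Fintype.card {i // x i = k} = Fintype.card {i // y i = k}) :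
    ∃ π : Equiv.Perm (Fin t), y = x ∘ π := by
  let e : ∀ k, {i // y i = k} ≃ {i // x i = k} := fun k => Fintype.equivOfCardEq (h k).symm
  exact ⟨Equiv.ofFiberEquiv e, funext fun i => (Equiv.ofFiberEquiv_map e i).symm⟩

theorem circle_exp_pow_mul {a b : ℕ} (hab : a ≠ b) :
    ((Circle.exp (Real.pi / ((a : ℝ) - b)) : Circle) : ℂ) ^ a
      * star ((Circle.exp (Real.pi / ((a : ℝ) - b)) : Circle) : ℂ) ^ b = -1 := by
  have hne : (a : ℂ) - b ≠ 0 := sub_ne_zero.mpr (by exact_mod_cast hab)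
  rw [Complex.star_def, ← Circle.coe_inv_eq_conj, ← Circle.exp_neg, Circle.coe_exp, Circle.coe_exp,
    ← Complex.exp_nat_mul, ← Complex.exp_nat_mul, ← Complex.exp_add, ← Complex.exp_pi_mul_I]
  congr 1
  push_cast
  field_simp
  ring

variable {ι : Type} [Fintype ι] [DecidableEq ι] {o : ι} {t : ℕ}

/-- If `k` occurs `a` times in `x` and `b ≠ a` times in `y`, a phase `ω` on the basis vector `k`
multiplies the entry by `ω^(a-b)`. With `ω = exp(iπ/(a-b))` the entry equals its own negative. -/
theorem haarMoment_eq_zero {x y : Fin t → ι} {k : ι}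
    (h : Fintype.card {i // x i = k} ≠ Fintype.card {i // y i = k}) :
    haarMoment o t x y = 0 := by
  set ω := Circle.exp (Real.pi / ((Fintype.card {i // x i = k} : ℝ)
    - Fintype.card {i // y i = k})) with hω
  have h1 := haarMoment_phase (o := o) (fun i => if i = k then ω else 1) x y
  have h2 : ∀ z : Fin t → ι, ∏ i, (((if z i = k then ω else 1 : Circle) : ℂ))
      = (ω : ℂ) ^ Fintype.card {i // z i = k} := by
    intro z
    rw [Fintype.card_subtype, ← Finset.prod_const, Finset.prod_filter]
    exact Finset.prod_congr rfl fun i _ => by split_ifs <;> simp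
  rw [Finset.prod_mul_distrib, h2, ← star_prod, h2, star_pow, hω, circle_exp_pow_mul h] at h1
  have h3 : (2 : ℂ) * haarMoment o t x y = 0 := by linear_combination h1
  simpa using h3

theorem haarMoment_comp_perm (x : Fin t → ι) (π : Equiv.Perm (Fin t)) :
    haarMoment o t x (x ∘ π) = haarMoment o t x x := by
  rw [haarMoment, haarMoment]
  refine integral_congr_ae (.of_forall fun U => ?_)
  simp only [Finset.prod_mul_distrib, Function.comp_apply]
  rw [Equiv.prod_comp π fun i => star ((U : Matrix ι ι ℂ) (x i) o)]

/-- On collision-free strings the moment operator is, up to a constant, the projector onto the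
symmetric subspace. -/
theorem exists_haarMoment_eq (o : ι) (t : ℕ) : ∃ c : ℂ, ∀ x : Fin t → ι, Function.Injective x →
    ∀ y, haarMoment o t x y
      = c * ∑ π : Equiv.Perm (Fin t), if y = x ∘ π then 1 else 0 := by
  by_cases hex : ∃ x₀ : Fin t → ι, Function.Injective x₀
  · obtain ⟨x₀, hx₀⟩ := hex
    -- A basis permutation carries `x₀` to any other injective string, so one diagonal entry serves
    -- as the constant for all of them.
    refine ⟨haarMoment o t x₀ x₀, fun x hx y => ?_⟩
    by_cases hy : ∃ π : Equiv.Perm (Fin t), y = x ∘ π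
    · obtain ⟨π, rfl⟩ := hy
      rw [haarMoment_comp_perm]
      obtain ⟨τ, rfl⟩ := exists_perm_comp_eq hx₀ hx
      rw [haarMoment_perm, Finset.sum_eq_single π]
      · simp
      · intro π' _ hne
        rw [if_neg]
        intro heq
        apply hne
        ext i
        exact congrArg _ (hx (congrFun heq i)).symm
      · simp
    · rw [Finset.sum_eq_zero, mul_zero]
      · by_contra hne
        refine hy (exists_comp_perm_eq fun k => ?_)
        by_contra hk
        exact hne (haarMoment_eq_zero hk)
      · intro π _
        rw [if_neg fun h => hy ⟨π, h⟩]
  · exact ⟨0, fun x hx => absurd ⟨x, hx⟩ hex⟩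

end Structure

/-! ### Second moments -/

section SecondMoment

variable {ι : Type} [Fintype ι] [DecidableEq ι]

theorem integrable_haarUnitary_real {f : Matrix.unitaryGroup ι ℂ → ℝ} (hf : Continuous f) :
    Integrable f (haarUnitary ι) :=
  hf.integrable_of_hasCompactSupport (HasCompactSupport.of_compactSpace f)

/-- The probability of measuring `i` in the column `o` of a unitary. -/
noncomputable def weight (o : ι) (U : Matrix.unitaryGroup ι ℂ) (i : ι) : ℝ :=
  Complex.normSq ((U : Matrix ι ι ℂ) i o)

theorem continuous_weight (o i : ι) : Continuous fun U => weight o U i :=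
  Complex.continuous_normSq.comp (continuous_unitary_entry i o)

theorem sum_weight (o : ι) (U : Matrix.unitaryGroup ι ℂ) : ∑ i, weight o U i = 1 := by
  have h := sum_normSq_col U o
  have h2 : ((∑ i, weight o U i : ℝ) : ℂ) = 1 := by
    rw [← h]
    push_cast
    exact Finset.sum_congr rfl fun i _ => (Complex.mul_conj _).symm
  exact_mod_cast h2

theorem haarMoment_self (o : ι) {t : ℕ} (x : Fin t → ι) :
    haarMoment o t x x = ((∫ U, ∏ i, weight o U (x i) ∂haarUnitary ι : ℝ) : ℂ) := by
  rw [haarMoment, ← integral_complex_ofReal]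
  refine integral_congr_ae (.of_forall fun U => ?_)
  push_cast
  exact Finset.prod_congr rfl fun i _ => Complex.mul_conj _

/-- The Hadamard gate on the span of two basis vectors. -/
noncomputable def hadamardPair (u v : ι) : Matrix ι ι ℂ :=
  1 + (Matrix.single u u (((√2)⁻¹ : ℝ) - 1 : ℂ) + Matrix.single u v (((√2)⁻¹ : ℝ) : ℂ)
    + Matrix.single v u (((√2)⁻¹ : ℝ) : ℂ) + Matrix.single v v (-((√2)⁻¹ : ℝ) - 1 : ℂ))

theorem inv_sqrt_two_sq : (((√2)⁻¹ : ℝ) : ℂ) * (((√2)⁻¹ : ℝ) : ℂ) = 1 / 2 := by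
  rw [← Complex.ofReal_mul, ← mul_inv, Real.mul_self_sqrt (by norm_num)]
  norm_num

theorem hadamardPair_mem {u v : ι} (huv : u ≠ v) :
    hadamardPair u v ∈ Matrix.unitaryGroup ι ℂ := by
  rw [Matrix.mem_unitaryGroup_iff, Matrix.star_eq_conjTranspose]
  have hs := inv_sqrt_two_sq
  set s : ℂ := (((√2)⁻¹ : ℝ) : ℂ) with hsdef
  have hstar : star s = s := Complex.conj_ofReal _
  have hH : (hadamardPair u v)ᴴ = hadamardPair u v := by
    simp only [hadamardPair, Matrix.conjTranspose_add, Matrix.conjTranspose_one,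
      Matrix.conjTranspose_single, star_sub, star_neg, star_one, ← hsdef, hstar]
    abel
  rw [hH]
  -- Writing the matrix as `1 + K`, it squares to `1` once `K² = -K - K`, which is checked on the
  -- four coefficients.
  have h1 : ∀ a b c d : ℂ, (Matrix.single u u a + Matrix.single u v b + Matrix.single v u c
      + Matrix.single v v d) * (Matrix.single u u a + Matrix.single u v b + Matrix.single v u c
      + Matrix.single v v d) = Matrix.single u u (a * a + b * c)
        + Matrix.single u v (a * b + b * d) + Matrix.single v u (c * a + d * c)
        + Matrix.single v v (c * b + d * d) := by
    intro a b c d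
    simp only [add_mul, mul_add, Matrix.single_mul_single_same,
      Matrix.single_mul_single_of_ne _ _ _ _ huv, Matrix.single_mul_single_of_ne _ _ _ _ huv.symm,
      Matrix.single_add]
    abel
  simp only [hadamardPair, ← hsdef]
  have h2 := h1 (s - 1) s s (-s - 1)
  have e1 : (s - 1) * (s - 1) + s * s = -(s - 1) - (s - 1) := by linear_combination 2 * hs
  have e2 : (s - 1) * s + s * (-s - 1) = -s - s := by ring
  have e3 : s * (s - 1) + (-s - 1) * s = -s - s := by ring
  have e4 : s * s + (-s - 1) * (-s - 1) = -(-s - 1) - (-s - 1) := by linear_combination 2 * hs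
  have hneg : ∀ (i j : ι) (x : ℂ),
      Matrix.single i j (-x - x) = -Matrix.single i j x - Matrix.single i j x := by
    intro i j x
    ext k l
    simp only [Matrix.single_apply, Matrix.sub_apply, Matrix.neg_apply]
    split_ifs <;> simp
  rw [e1, e2, e3, e4] at h2
  simp only [hneg] at h2
  rw [mul_add, add_mul, one_mul, mul_one, add_mul, one_mul, h2]
  abel

theorem hadamardPair_mul_apply {u v : ι} (huv : u ≠ v) {κ : Type*} (M : Matrix ι κ ℂ) (j : κ) :
    (hadamardPair u v * M) u j = (((√2)⁻¹ : ℝ) : ℂ) * (M u j + M v j) := by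
  simp only [hadamardPair, Matrix.add_mul, Matrix.one_mul, Matrix.add_apply,
    Matrix.single_mul_apply_same, Matrix.single_mul_apply_of_ne _ _ _ _ _ huv]
  ring

/-- Integrals over Haar unitaries are left invariant. -/
theorem integral_unitary_mul_real (W : Matrix.unitaryGroup ι ℂ)
    (f : Matrix.unitaryGroup ι ℂ → ℝ) :
    ∫ U, f (W * U) ∂haarUnitary ι = ∫ U, f U ∂haarUnitary ι :=
  integral_mul_left_eq_self f W

/-- Averaging `|a + ωb|⁴` over the fourth roots of unity kills every phase-dependent term. -/
theorem normSq_sq_four_phases (a b : ℂ) :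
    Complex.normSq (a + b) ^ 2 + Complex.normSq (a - b) ^ 2
      + Complex.normSq (a + Complex.I * b) ^ 2 + Complex.normSq (a - Complex.I * b) ^ 2
    = 4 * (Complex.normSq a ^ 2 + Complex.normSq b ^ 2
      + 4 * (Complex.normSq a * Complex.normSq b)) := by
  simp only [Complex.normSq_apply, Complex.add_re, Complex.add_im, Complex.sub_re, Complex.sub_im,
    Complex.mul_re, Complex.mul_im, Complex.I_re, Complex.I_im]
  ring

theorem integral_weight_sq_eq (o u v : ι) :
    ∫ U, weight o U u ^ 2 ∂haarUnitary ι = ∫ U, weight o U v ^ 2 ∂haarUnitary ι := by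
  rw [← integral_unitary_mul_real (permUnitary (Equiv.swap v u))]
  refine integral_congr_ae (.of_forall fun U => ?_)
  have h := basisMap_mul_apply (Equiv.swap v u) (U : Matrix ι ι ℂ) v o
  rw [Equiv.swap_apply_left] at h
  simp only [weight, permUnitary, Submonoid.coe_mul]
  rw [h]

/-- A phase `ω` on `v` followed by the Hadamard gate on `u, v` preserves Haar measure and turns
entry `u` into `(a + ωb)/√2`. Averaging over the four phases gives `4 E[w_u²] = E[w_u²] + E[w_v²] +
4 E[w_u w_v]`, and the two squares have equal means. -/
theorem integral_weight_sq_eq_two_mul (o : ι) {u v : ι} (huv : u ≠ v) :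
    ∫ U, weight o U u ^ 2 ∂haarUnitary ι
      = 2 * ∫ U, weight o U u * weight o U v ∂haarUnitary ι := by
  have key : ∀ ω : Circle, ∫ U, weight o U u ^ 2 ∂haarUnitary ι
      = ∫ U : Matrix.unitaryGroup ι ℂ, (1 / 4) * Complex.normSq ((U : Matrix ι ι ℂ) u o
        + ω * (U : Matrix ι ι ℂ) v o) ^ 2 ∂haarUnitary ι := by
    intro ω
    rw [← integral_unitary_mul_real
      (⟨hadamardPair u v, hadamardPair_mem huv⟩ * phaseUnitary fun i => if i = v then ω else 1)]
    refine integral_congr_ae (.of_forall fun U => ?_)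
    have hs : Complex.normSq (((√2)⁻¹ : ℝ) : ℂ) = 1 / 2 := by
      rw [Complex.normSq_ofReal, ← mul_inv, Real.mul_self_sqrt (by norm_num)]
      norm_num
    simp only [weight, Submonoid.coe_mul, mul_assoc, hadamardPair_mul_apply huv, phaseUnitary,
      Matrix.diagonal_mul, huv, if_true, if_false, Circle.coe_one, one_mul, Complex.normSq_mul, hs]
    ring
  have hI : ∀ ω : ℂ, Integrable (fun U : Matrix.unitaryGroup ι ℂ =>
      (1 / 4) * Complex.normSq ((U : Matrix ι ι ℂ) u o + ω * (U : Matrix ι ι ℂ) v o) ^ 2)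
      (haarUnitary ι) := fun ω => integrable_haarUnitary_real <|
    continuous_const.mul ((Complex.continuous_normSq.comp ((continuous_unitary_entry u o).add
      (continuous_const.mul (continuous_unitary_entry v o)))).pow 2)
  let i : Circle := ⟨Complex.I, by simp [Submonoid.unitSphere]⟩
  have hsum : 4 * ∫ U, weight o U u ^ 2 ∂haarUnitary ι
      = ∫ U, (weight o U u ^ 2 + weight o U v ^ 2
        + 4 * (weight o U u * weight o U v)) ∂haarUnitary ι := by
    have h1 := key 1
    have h2 := key (-1)
    have h3 := key i
    have h4 := key (-i)
    have hadd := integral_add (((hI 1).add (hI (-1))).add (hI Complex.I)) (hI (-Complex.I))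
    rw [integral_add' ((hI 1).add (hI (-1))) (hI Complex.I), integral_add' (hI 1) (hI (-1))] at hadd
    have hi : ((-i : Circle) : ℂ) = -Complex.I := rfl
    simp only [Circle.coe_one, Circle.coe_neg 1] at h1 h2
    rw [hi] at h4
    simp only [i] at h3
    refine Eq.trans (Eq.trans ?_ hadd.symm) ?_
    · linarith
    refine integral_congr_ae (.of_forall fun U => ?_)
    have h6 := normSq_sq_four_phases ((U : Matrix ι ι ℂ) u o) ((U : Matrix ι ι ℂ) v o)
    simp only [Pi.add_apply, weight, one_mul, neg_mul, ← sub_eq_add_neg]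
    linarith
  have c1 : Continuous fun U => weight o U u := continuous_weight o u
  have c2 : Continuous fun U => weight o U v := continuous_weight o v
  rw [integral_add, integral_add, integral_const_mul, ← integral_weight_sq_eq o u v] at hsum
  · linarith
  · exact integrable_haarUnitary_real (c1.pow 2)
  · exact integrable_haarUnitary_real (c2.pow 2)
  · exact integrable_haarUnitary_real ((c1.pow 2).add (c2.pow 2))
  · exact integrable_haarUnitary_real (continuous_const.mul (c1.mul c2))

theorem integral_weight_mul (o u v : ι) :
    ∫ U, weight o U u * weight o U v ∂haarUnitary ι
      = ((Fintype.card ι : ℝ) * (Fintype.card ι + 1))⁻¹ * (1 + if u = v then 1 else 0) := by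
  set e : ℝ := (∫ U, weight o U o ^ 2 ∂haarUnitary ι) / 2 with he
  have h : ∀ u v, ∫ U, weight o U u * weight o U v ∂haarUnitary ι
      = e * (1 + if u = v then 1 else 0) := by
    intro u v
    split_ifs with huv
    · subst huv
      have := integral_weight_sq_eq o u o
      simp only [pow_two] at this he
      rw [this, he]
      ring
    · have h1 := integral_weight_sq_eq_two_mul o huv
      rw [integral_weight_sq_eq o u o] at h1
      rw [he, h1]
      ring
  have hint : ∀ u v, Integrable (fun U => weight o U u * weight o U v) (haarUnitary ι) :=
    fun u v => integrable_haarUnitary_real ((continuous_weight o u).mul (continuous_weight o v))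
  -- Normalization fixes the one unknown: `e (d² + d) = 1` in dimension `d`.
  have hsum : ∑ u, ∑ v, ∫ U, weight o U u * weight o U v ∂haarUnitary ι = 1 := by
    have h1 : ∀ u, ∑ v, ∫ U, weight o U u * weight o U v ∂haarUnitary ι
        = ∫ U, ∑ v, weight o U u * weight o U v ∂haarUnitary ι := fun u =>
      (integral_finsetSum _ fun v _ => hint u v).symm
    simp only [h1]
    rw [← integral_finsetSum _ fun u _ => integrable_finsetSum _ fun v _ => hint u v]
    have h2 : ∀ U, ∑ u, ∑ v, weight o U u * weight o U v = 1 := fun U => by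
      rw [← Finset.sum_mul_sum, sum_weight, one_mul]
    simp only [h2, integral_const, probReal_univ, one_smul]
  simp only [h, ← Finset.mul_sum, Finset.sum_add_distrib, Finset.sum_ite_eq, Finset.mem_univ,
    if_true, Finset.sum_const, Finset.card_univ, nsmul_eq_mul, mul_one] at hsum
  rw [h, eq_inv_of_mul_eq_one_left (a := e) (b := (Fintype.card ι : ℝ) * (Fintype.card ι + 1))]
  linarith

end SecondMoment

/-! ### Collision probabilities -/

section Collision

/-- Under the product distribution of `w`, the positions other than `i` and `j` sum out to `1`. -/
theorem sum_prod_collision {ι A : Type*} [Fintype ι] [DecidableEq ι] [DecidableEq A] [Fintype A]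
    {t : ℕ} (p : ι → A) (w : ι → ℝ) (hw : ∑ u, w u = 1) {i j : Fin t} (hij : i ≠ j) :
    ∑ x : Fin t → ι, (if p (x i) = p (x j) then ∏ k, w (x k) else 0)
      = ∑ u, ∑ v, if p u = p v then w u * w v else 0 := by
  have h1 : ∀ x : Fin t → ι, (if p (x i) = p (x j) then ∏ k, w (x k) else 0)
      = ∑ u, ∑ v, (if p u = p v then (1 : ℝ) else 0)
        * ∏ k, (if (k = i → x k = u) ∧ (k = j → x k = v) then w (x k) else 0) := by
    intro x
    rw [Finset.sum_eq_single (x i), Finset.sum_eq_single (x j)]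
    · rw [ite_mul, one_mul, zero_mul]
      refine if_congr Iff.rfl (Finset.prod_congr rfl fun k _ => ?_) rfl
      rw [if_pos]
      exact ⟨fun h => by rw [h], fun h => by rw [h]⟩
    · intro v _ hv
      rw [Finset.prod_eq_zero (Finset.mem_univ j), mul_zero]
      rw [if_neg]
      exact fun h => hv (h.2 rfl).symm
    · simp
    · intro u _ hu
      refine Finset.sum_eq_zero fun v _ => ?_
      rw [Finset.prod_eq_zero (Finset.mem_univ i), mul_zero]
      rw [if_neg]
      exact fun h => hu (h.1 rfl).symm
    · simp
  simp only [h1]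
  rw [Finset.sum_comm]
  refine Finset.sum_congr rfl fun u _ => ?_
  rw [Finset.sum_comm]
  refine Finset.sum_congr rfl fun v _ => ?_
  rw [← Finset.mul_sum, ← Fintype.prod_sum fun k z =>
    if (k = i → z = u) ∧ (k = j → z = v) then w z else 0]
  rw [← Finset.mul_prod_erase _ _ (Finset.mem_univ i),
    ← Finset.mul_prod_erase _ _ (Finset.mem_erase.mpr ⟨hij.symm, Finset.mem_univ j⟩),
    Finset.prod_eq_one]
  · simp [hij, hij.symm]
  · intro k hk
    simp only [Finset.mem_erase] at hk
    simp [hk.1, hk.2.1, hw]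

variable {ι : Type} [Fintype ι] [DecidableEq ι]

theorem haarMoment_self_nonneg (o : ι) {t : ℕ} (x : Fin t → ι) :
    0 ≤ (haarMoment o t x x).re :=
  (Complex.nonneg_iff.mp (posSemidef_haarMoment.diag_nonneg (i := x))).1

theorem sum_haarMoment_self (o : ι) (t : ℕ) :
    ∑ x : Fin t → ι, (haarMoment o t x x).re = 1 := by
  have h := congrArg Complex.re (trace_haarMoment (o := o) (t := t))
  simpa [Matrix.trace] using h

theorem haarMoment_collision_le {A B : Type*} [Fintype A] [DecidableEq A] [Fintype B]
    (e : ι ≃ A × B) (o : ι) {t : ℕ} {i j : Fin t} (hij : i ≠ j) :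
    ∑ x : Fin t → ι, (if (e (x i)).1 = (e (x j)).1 then (haarMoment o t x x).re else 0)
      ≤ 2 / Fintype.card A := by
  have c : ∀ u, Continuous fun U => weight o U u := continuous_weight o
  have h1 : ∀ x : Fin t → ι,
      (if (e (x i)).1 = (e (x j)).1 then (haarMoment o t x x).re else 0)
      = ∫ U, (if (e (x i)).1 = (e (x j)).1 then ∏ k, weight o U (x k) else 0)
        ∂haarUnitary ι := by
    intro x
    rw [haarMoment_self, Complex.ofReal_re]
    split_ifs <;> simp
  have h2 : ∀ u v, (∫ U, if (e u).1 = (e v).1 then weight o U u * weight o U v else 0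
      ∂haarUnitary ι) = ((Fintype.card ι : ℝ) * (Fintype.card ι + 1))⁻¹
        * ((if (e u).1 = (e v).1 then 1 else 0) + if u = v then 1 else 0) := by
    intro u v
    split_ifs with ha hb hb
    · rw [integral_weight_mul, if_pos hb]
    · rw [integral_weight_mul, if_neg hb]
    · exact absurd (by rw [hb]) ha
    · simp
  have hint1 : ∀ x : Fin t → ι, Integrable (fun U =>
      if (e (x i)).1 = (e (x j)).1 then ∏ k, weight o U (x k) else 0) (haarUnitary ι) := by
    intro x
    split_ifs
    · exact integrable_haarUnitary_real (continuous_finsetProd _ fun k _ => c _)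
    · exact integrable_zero _ _ _
  have hint2 : ∀ u v, Integrable (fun U =>
      if (e u).1 = (e v).1 then weight o U u * weight o U v else 0) (haarUnitary ι) := by
    intro u v
    split_ifs
    · exact integrable_haarUnitary_real ((c u).mul (c v))
    · exact integrable_zero _ _ _
  simp only [h1]
  rw [← integral_finsetSum _ fun x _ => hint1 x]
  have h3 : ∀ U, ∑ x : Fin t → ι,
      (if (e (x i)).1 = (e (x j)).1 then ∏ k, weight o U (x k) else 0)
      = ∑ u, ∑ v, if (e u).1 = (e v).1 then weight o U u * weight o U v else 0 := fun U =>
    sum_prod_collision (fun u => (e u).1) (weight o U) (sum_weight o U) hij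
  simp only [h3]
  rw [integral_finsetSum _ fun u _ => integrable_finsetSum _ fun v _ => hint2 u v]
  simp only [integral_finsetSum _ fun v _ => hint2 _ v, h2]
  simp only [← Finset.mul_sum, Finset.sum_add_distrib, Finset.sum_ite_eq, Finset.mem_univ,
    if_true, Finset.sum_const, Finset.card_univ, nsmul_eq_mul, mul_one]
  have h4 : ∀ u, (∑ v, if (e u).1 = (e v).1 then (1 : ℝ) else 0) = Fintype.card B := by
    intro u
    rw [Fintype.sum_equiv e _ (fun ab : A × B => if (e u).1 = ab.1 then (1 : ℝ) else 0)
      fun v => rfl, Fintype.sum_prod_type_right]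
    simp
  simp only [h4, Finset.sum_const, Finset.card_univ, nsmul_eq_mul]
  have hcard : (Fintype.card ι : ℝ) = Fintype.card A * Fintype.card B := by
    rw [Fintype.card_congr e, Fintype.card_prod]
    push_cast
    rfl
  have hA : (1 : ℝ) ≤ Fintype.card A := by
    exact_mod_cast Fintype.card_pos_iff.mpr ⟨(e o).1⟩
  have hB : (1 : ℝ) ≤ Fintype.card B := by
    exact_mod_cast Fintype.card_pos_iff.mpr ⟨(e o).2⟩
  rw [hcard, inv_mul_eq_div, div_le_div_iff₀ (by positivity) (by positivity)]
  generalize (Fintype.card A : ℝ) = a at *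
  generalize (Fintype.card B : ℝ) = b at *
  -- The exact collision probability is `(b + 1) / (ab + 1)`; this bounds it by `2 / a`.
  have h5 : a * (b + 1) ≤ 2 * (a * b + 1) := by nlinarith
  have h6 : 0 ≤ a * b := by positivity
  nlinarith [mul_le_mul_of_nonneg_left h5 h6]

/-- Strings none of whose two halves has a repeated symbol. -/
abbrev CollisionFree {ι A B : Type*} (e : ι ≃ A × B) {t : ℕ} (x : Fin t → ι) : Prop :=
  Function.Injective (fun i => (e (x i)).1) ∧ Function.Injective (fun i => (e (x i)).2)

theorem CollisionFree.injective {ι A B : Type*} {e : ι ≃ A × B} {t : ℕ} {x : Fin t → ι}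
    (hx : CollisionFree e x) : Function.Injective x := fun i j h => hx.1 (by simp only [h])

theorem CollisionFree.comp_perm {ι A B : Type*} {e : ι ≃ A × B} {t : ℕ} {x : Fin t → ι}
    (hx : CollisionFree e x) (π : Equiv.Perm (Fin t)) : CollisionFree e (x ∘ π) :=
  ⟨hx.1.comp π.injective, hx.2.comp π.injective⟩

/-- The weight of the moment operator on collision-free strings. -/
noncomputable def goodWeight {A B : Type*} [DecidableEq A] [DecidableEq B]
    (e : ι ≃ A × B) (o : ι) (t : ℕ) : ℝ :=
  ∑ x : Fin t → ι, if CollisionFree e x then (haarMoment o t x x).re else 0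

variable {A B : Type*} [Fintype A] [DecidableEq A] [Fintype B] [DecidableEq B]

omit [Fintype A] [Fintype B] in
theorem one_sub_goodWeight_eq (e : ι ≃ A × B) (o : ι) (t : ℕ) :
    1 - goodWeight e o t
      = ∑ x : Fin t → ι, if ¬ CollisionFree e x then (haarMoment o t x x).re else 0 := by
  rw [goodWeight, ← sum_haarMoment_self o t, ← Finset.sum_sub_distrib]
  exact Finset.sum_congr rfl fun x _ => by split_ifs <;> simp_all

/-- Union bound over ordered pairs of positions, for collisions in either half. -/
theorem one_sub_goodWeight_le (e : ι ≃ A × B) (o : ι) (t : ℕ) :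
    1 - goodWeight e o t ≤ (t : ℝ) ^ 2 * (2 / Fintype.card A + 2 / Fintype.card B) := by
  rw [one_sub_goodWeight_eq]
  let r : (Fin t → ι) → ℝ := fun x => (haarMoment o t x x).re
  have hr : ∀ x, 0 ≤ r x := haarMoment_self_nonneg o
  let f : Fin t → Fin t → (Fin t → ι) → ℝ := fun i j x =>
    if i = j then 0 else (if (e (x i)).1 = (e (x j)).1 then r x else 0)
      + (if (e (x i)).2 = (e (x j)).2 then r x else 0)
  have hf : ∀ i j x, 0 ≤ f i j x := by
    intro i j x
    have := hr x
    simp only [f]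
    split_ifs <;> linarith
  have h1 : ∀ x : Fin t → ι, (if ¬ CollisionFree e x then r x else 0) ≤ ∑ i, ∑ j, f i j x := by
    intro x
    by_cases hx : CollisionFree e x
    swap
    · rw [if_pos hx]
      have hex : ∃ i j, i ≠ j ∧ ((e (x i)).1 = (e (x j)).1 ∨ (e (x i)).2 = (e (x j)).2) := by
        by_contra! hcon
        refine hx ⟨fun i j h => ?_, fun i j h => ?_⟩
        · by_contra hne
          exact (hcon i j hne).1 h
        · by_contra hne
          exact (hcon i j hne).2 h
      obtain ⟨i, j, hne, hor⟩ := hex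
      have h2 : r x ≤ f i j x := by
        have := hr x
        simp only [f, if_neg hne]
        rcases hor with h | h
        · rw [if_pos h]
          split_ifs <;> linarith
        · rw [if_pos h]
          split_ifs <;> linarith
      exact h2.trans ((Finset.single_le_sum (f := fun j => f i j x) (fun j _ => hf i j x)
        (Finset.mem_univ j)).trans (Finset.single_le_sum (f := fun i => ∑ j, f i j x)
          (fun i _ => Finset.sum_nonneg fun j _ => hf i j x) (Finset.mem_univ i)))
    · rw [if_neg (not_not.mpr hx)]
      exact Finset.sum_nonneg fun i _ => Finset.sum_nonneg fun j _ => hf i j x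
  have h2 : ∀ i j, ∑ x, f i j x ≤ 2 / Fintype.card A + 2 / Fintype.card B := by
    intro i j
    by_cases hij : i = j
    · simp only [f, if_pos hij, Finset.sum_const_zero]
      positivity
    · simp only [f, if_neg hij, Finset.sum_add_distrib]
      exact add_le_add (haarMoment_collision_le e o hij)
        (haarMoment_collision_le (e.trans (Equiv.prodComm A B)) o hij)
  calc ∑ x : Fin t → ι, (if ¬ CollisionFree e x then r x else 0)
      ≤ ∑ x, ∑ i, ∑ j, f i j x := Finset.sum_le_sum fun x _ => h1 x
    _ = ∑ i, ∑ j, ∑ x, f i j x := by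
      rw [Finset.sum_comm]
      exact Finset.sum_congr rfl fun i _ => Finset.sum_comm
    _ ≤ ∑ _i : Fin t, ∑ _j : Fin t, (2 / (Fintype.card A : ℝ) + 2 / Fintype.card B) :=
      Finset.sum_le_sum fun i _ => Finset.sum_le_sum fun j _ => h2 i j
    _ = _ := by
      simp only [Finset.sum_const, Finset.card_univ, Fintype.card_fin, nsmul_eq_mul]
      ring

end Collision

/-! ### Comparing two moment operators after twirling the second register -/

section Compare

theorem posSemidef_ite {I : Type*} [Fintype I] [DecidableEq I] {R : Matrix I I ℂ}
    (hR : R.PosSemidef) (P : I → Prop) [DecidablePred P] :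
    Matrix.PosSemidef (Matrix.of fun x y => if P x ∧ P y then R x y else 0) := by
  have h := hR.mul_mul_conjTranspose_same (Matrix.diagonal fun x => if P x then (1 : ℂ) else 0)
  convert h using 1
  ext x y
  rw [Matrix.diagonal_conjTranspose, Matrix.mul_diagonal, Matrix.diagonal_mul]
  by_cases hx : P x <;> by_cases hy : P y <;> simp [hx, hy]

variable {ι A B : Type} [Fintype ι] [DecidableEq ι] [Fintype A] [DecidableEq A] [Fintype B]
  [DecidableEq B]

/-- The restriction of the moment operator to collision-free strings. -/
noncomputable def goodPart (e : ι ≃ A × B) (o : ι) (t : ℕ) :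
    Matrix (Fin t → ι) (Fin t → ι) ℂ :=
  Matrix.of fun x y => if CollisionFree e x ∧ CollisionFree e y then haarMoment o t x y else 0

/-- The restriction of the moment operator to strings with collisions. -/
noncomputable def badPart (e : ι ≃ A × B) (o : ι) (t : ℕ) :
    Matrix (Fin t → ι) (Fin t → ι) ℂ :=
  Matrix.of fun x y => if ¬ CollisionFree e x ∧ ¬ CollisionFree e y then haarMoment o t x y else 0

-- Entries in the row of an injective string live on its rearrangements, and these stay
-- collision-free. The moment operator is thus block diagonal, which makes the error linear in the
-- missing weight.
omit [Fintype A] [Fintype B] [DecidableEq A] [DecidableEq B] in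
theorem haarMoment_eq_zero_of_collision {e : ι ≃ A × B} {o : ι} {t : ℕ} {x y : Fin t → ι}
    (hx : CollisionFree e x) (hy : ¬ CollisionFree e y) : haarMoment o t x y = 0 := by
  obtain ⟨c, hc⟩ := exists_haarMoment_eq o t
  rw [hc x hx.injective, Finset.sum_eq_zero, mul_zero]
  intro π _
  rw [if_neg]
  rintro rfl
  exact hy (hx.comp_perm π)

omit [Fintype A] [Fintype B] in
theorem haarMoment_eq_goodPart_add_badPart (e : ι ≃ A × B) (o : ι) (t : ℕ) :
    haarMoment o t = goodPart e o t + badPart e o t := by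
  ext x y
  simp only [goodPart, badPart, Matrix.add_apply, Matrix.of_apply]
  by_cases hx : CollisionFree e x <;> by_cases hy : CollisionFree e y
  · simp [hx, hy]
  · simp [hx, hy, haarMoment_eq_zero_of_collision hx hy]
  · have h := (posSemidef_haarMoment (o := o) (t := t)).1.apply x y
    rw [haarMoment_eq_zero_of_collision hy hx, star_zero] at h
    simp [hx, hy, ← h]
  · simp [hx, hy]

omit [Fintype A] [Fintype B] in
theorem trace_goodPart (e : ι ≃ A × B) (o : ι) (t : ℕ) :
    (goodPart e o t).trace.re = goodWeight e o t := by
  simp only [Matrix.trace, Matrix.diag, goodPart, Matrix.of_apply, and_self, Complex.re_sum,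
    goodWeight]
  exact Finset.sum_congr rfl fun x _ => by split_ifs <;> simp

omit [Fintype A] [Fintype B] in
theorem trace_badPart (e : ι ≃ A × B) (o : ι) (t : ℕ) :
    (badPart e o t).trace.re = 1 - goodWeight e o t := by
  rw [one_sub_goodWeight_eq]
  simp only [Matrix.trace, Matrix.diag, badPart, Matrix.of_apply, and_self, Complex.re_sum]
  exact Finset.sum_congr rfl fun x _ => by split_ifs <;> simp

-- Collision-free strings are exactly pairs of independently chosen injective strings; the second
-- half contributes only a count.
omit [DecidableEq ι] in
theorem sum_collisionFree (e : ι ≃ A × B) {t : ℕ} (f : (Fin t → A) → ℂ) :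
    ∑ x : Fin t → ι, (if CollisionFree e x then f (fun i => (e (x i)).1) else 0)
      = (∑ b : Fin t → B, if Function.Injective b then 1 else 0)
        * ∑ a : Fin t → A, if Function.Injective a then f a else 0 := by
  let E : (Fin t → ι) ≃ (Fin t → A) × (Fin t → B) :=
    ((Equiv.refl (Fin t)).arrowCongr e).trans (Equiv.arrowProdEquivProdArrow _ _ _)
  refine (Fintype.sum_equiv E _ (fun ab : (Fin t → A) × (Fin t → B) =>
    if Function.Injective ab.1 ∧ Function.Injective ab.2 then f ab.1 else 0) fun x => rfl).trans ?_
  rw [Fintype.sum_prod_type_right, Finset.sum_mul_sum]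
  refine Finset.sum_congr rfl fun b _ => Finset.sum_congr rfl fun a _ => ?_
  by_cases ha : Function.Injective a <;> by_cases hb : Function.Injective b <;> simp [ha, hb]

/-- A functional whose values on collision-free matrix units depend on the first halves only is
determined on the collision-free part by its weight. -/
theorem map_goodPart (e : ι ≃ A × B) (o : ι) {t : ℕ}
    (F : Matrix (Fin t → ι) (Fin t → ι) ℂ →ₗ[ℂ] ℂ) (H : (Fin t → A) → Equiv.Perm (Fin t) → ℂ)
    (hF : ∀ x, CollisionFree e x → ∀ π : Equiv.Perm (Fin t),
      F (Matrix.single x (x ∘ π) 1) = H (fun i => (e (x i)).1) π)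
    (hA : ∃ a : Fin t → A, Function.Injective a) :
    F (goodPart e o t) = (goodWeight e o t : ℂ)
      * ((∑ a, if Function.Injective a then ∑ π, H a π else 0)
        / ∑ a : Fin t → A, if Function.Injective a then 1 else 0) := by
  obtain ⟨c, hc⟩ := exists_haarMoment_eq o t
  have hself : ∀ x : Fin t → ι, CollisionFree e x → haarMoment o t x x = c := by
    intro x hx
    rw [hc x hx.injective, Finset.sum_eq_single 1]
    · simp
    · intro π _ hne
      rw [if_neg]
      intro h
      apply hne
      ext i
      exact congrArg _ (hx.injective (congrFun h i)).symm
    · simp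
  -- The weight is `c` times the number of collision-free strings, so `c` and the size of `B` drop
  -- out of the final ratio.
  have hw : (goodWeight e o t : ℂ) = c * ((∑ b : Fin t → B, if Function.Injective b then 1 else 0)
      * ∑ a : Fin t → A, if Function.Injective a then 1 else 0) := by
    rw [← sum_collisionFree e fun _ => 1, goodWeight, Complex.ofReal_sum, Finset.mul_sum]
    refine Finset.sum_congr rfl fun x _ => ?_
    by_cases hx : CollisionFree e x
    · rw [if_pos hx, if_pos hx, mul_one, ← hself x hx, haarMoment_self, Complex.ofReal_re]
    · simp [hx]
  have hgood : goodPart e o t = ∑ x : Fin t → ι, if CollisionFree e x then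
      ∑ π : Equiv.Perm (Fin t), c • Matrix.single x (x ∘ π) (1 : ℂ) else 0 := by
    ext x y
    rw [Matrix.sum_apply, Finset.sum_eq_single x]
    · simp only [goodPart, Matrix.of_apply]
      by_cases hx : CollisionFree e x
      · rw [if_pos hx, Matrix.sum_apply]
        have h1 : (if CollisionFree e x ∧ CollisionFree e y then haarMoment o t x y else 0)
            = haarMoment o t x y := by
          by_cases hy : CollisionFree e y
          · rw [if_pos ⟨hx, hy⟩]
          · rw [if_neg fun h => hy h.2, haarMoment_eq_zero_of_collision hx hy]
        rw [h1, hc x hx.injective, Finset.mul_sum]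
        refine Finset.sum_congr rfl fun π _ => ?_
        rw [Matrix.smul_apply, Matrix.single_apply, smul_eq_mul]
        exact congrArg _ (if_congr ⟨fun h => ⟨rfl, h.symm⟩, fun h => h.2.symm⟩ rfl rfl)
      · rw [if_neg hx, if_neg fun h => hx h.1, Matrix.zero_apply]
    · intro x' _ hne
      split_ifs
      · rw [Matrix.sum_apply]
        refine Finset.sum_eq_zero fun π _ => ?_
        rw [Matrix.smul_apply, Matrix.single_apply, if_neg fun h => hne h.1, smul_zero]
      · rfl
    · simp
  have hFgood : F (goodPart e o t)
      = c * ∑ x : Fin t → ι, if CollisionFree e x then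
        ∑ π, H (fun i => (e (x i)).1) π else 0 := by
    rw [hgood, map_sum, Finset.mul_sum]
    refine Finset.sum_congr rfl fun x _ => ?_
    by_cases hx : CollisionFree e x
    · rw [if_pos hx, if_pos hx, map_sum, Finset.mul_sum]
      exact Finset.sum_congr rfl fun π _ => by rw [map_smul, hF x hx π, smul_eq_mul]
    · rw [if_neg hx, if_neg hx, map_zero, mul_zero]
  have hne : (∑ a : Fin t → A, if Function.Injective a then (1 : ℂ) else 0) ≠ 0 := by
    obtain ⟨a, ha⟩ := hA
    rw [Finset.sum_boole]
    exact_mod_cast (Finset.card_pos.mpr ⟨a, by simpa using ha⟩).ne'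
  rw [hFgood, sum_collisionFree e fun a => ∑ π, H a π, hw]
  field_simp

variable {ι' B' : Type} [Fintype ι'] [DecidableEq ι'] [Fintype B'] [DecidableEq B']

theorem norm_map_haarMoment_le (o : ι) {t : ℕ} (F : Matrix (Fin t → ι) (Fin t → ι) ℂ →ₗ[ℂ] ℂ)
    (hF : ∀ X : Matrix (Fin t → ι) (Fin t → ι) ℂ, X.PosSemidef → ‖F X‖ ≤ X.trace.re) :
    ‖F (haarMoment o t)‖ ≤ 1 := by
  have h := hF _ (posSemidef_haarMoment (o := o) (t := t))
  rwa [trace_haarMoment, Complex.one_re] at h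

omit [Fintype A] [Fintype B] in
theorem goodWeight_eq_zero (e : ι ≃ A × B) (o : ι) {t : ℕ}
    (h : ¬ ∃ x : Fin t → ι, CollisionFree e x) : goodWeight e o t = 0 :=
  Finset.sum_eq_zero fun x _ => if_neg fun hx => h ⟨x, hx⟩

omit [Fintype A] [Fintype B] in
theorem goodWeight_nonneg (e : ι ≃ A × B) (o : ι) (t : ℕ) : 0 ≤ goodWeight e o t :=
  Finset.sum_nonneg fun x _ => by
    have := haarMoment_self_nonneg o x
    split_ifs <;> simp [this]

omit [Fintype A] [Fintype B] in
theorem goodWeight_le_one (e : ι ≃ A × B) (o : ι) (t : ℕ) : goodWeight e o t ≤ 1 := by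
  have h := one_sub_goodWeight_eq e o t
  have h2 : 0 ≤ 1 - goodWeight e o t := by
    rw [h]
    exact Finset.sum_nonneg fun x _ => by
      have := haarMoment_self_nonneg o x
      split_ifs <;> simp [this]
  linarith

/-- Two functionals that agree on collision-free matrix units with equal first halves take nearly
equal values on the moment operators. -/
theorem norm_map_haarMoment_sub_le (e : ι ≃ A × B) (e' : ι' ≃ A × B') (o : ι) (o' : ι') {t : ℕ}
    (F : Matrix (Fin t → ι) (Fin t → ι) ℂ →ₗ[ℂ] ℂ)
    (F' : Matrix (Fin t → ι') (Fin t → ι') ℂ →ₗ[ℂ] ℂ)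
    (hF : ∀ X : Matrix (Fin t → ι) (Fin t → ι) ℂ, X.PosSemidef → ‖F X‖ ≤ X.trace.re)
    (hF' : ∀ X : Matrix (Fin t → ι') (Fin t → ι') ℂ, X.PosSemidef → ‖F' X‖ ≤ X.trace.re)
    (hFF' : ∀ x x', CollisionFree e x → CollisionFree e' x' →
      (fun i => (e (x i)).1) = (fun i => (e' (x' i)).1) → ∀ π : Equiv.Perm (Fin t),
      F (Matrix.single x (x ∘ π) 1) = F' (Matrix.single x' (x' ∘ π) 1)) :
    ‖F (haarMoment o t) - F' (haarMoment o' t)‖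
      ≤ 2 * ((1 - goodWeight e o t) + (1 - goodWeight e' o' t)) := by
  have htriv := (norm_sub_le (F (haarMoment o t)) (F' (haarMoment o' t))).trans
    (add_le_add (norm_map_haarMoment_le o F hF) (norm_map_haarMoment_le o' F' hF'))
  have hg1 := goodWeight_le_one e o t
  have hg1' := goodWeight_le_one e' o' t
  -- Without collision-free strings the weight is `0` and the right side is at least `2`, the
  -- trivial bound.
  by_cases hex : ∃ x : Fin t → ι, CollisionFree e x
  swap
  · rw [goodWeight_eq_zero e o hex]
    linarith
  by_cases hex' : ∃ x : Fin t → ι', CollisionFree e' x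
  swap
  · rw [goodWeight_eq_zero e' o' hex']
    linarith
  obtain ⟨x₀, hx₀⟩ := hex
  obtain ⟨x₀', hx₀'⟩ := hex'
  have hA : ∃ a : Fin t → A, Function.Injective a := ⟨_, hx₀.1⟩
  -- Representatives with prescribed first halves and a fixed collision-free second half.
  let y : (Fin t → A) → Fin t → ι := fun a i => e.symm (a i, (e (x₀ i)).2)
  let y' : (Fin t → A) → Fin t → ι' := fun a i => e'.symm (a i, (e' (x₀' i)).2)
  have hy : ∀ a, Function.Injective a → CollisionFree e (y a) := fun a ha => by
    refine ⟨?_, ?_⟩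
    · simpa [y] using ha
    · simpa [y] using hx₀.2
  have hy' : ∀ a, Function.Injective a → CollisionFree e' (y' a) := fun a ha => by
    refine ⟨?_, ?_⟩
    · simpa [y'] using ha
    · simpa [y'] using hx₀'.2
  let H : (Fin t → A) → Equiv.Perm (Fin t) → ℂ := fun a π =>
    F' (Matrix.single (y' a) (y' a ∘ π) 1)
  have h1 := map_goodPart e o F H (fun x hx π =>
    hFF' x _ hx (hy' _ hx.1) (by simp [y']) π) hA
  -- The hypothesis only compares `F` with `F'`, so two values of `F'` are compared through a value
  -- of `F`.
  have h2 := map_goodPart e' o' F' H (fun x hx π => by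
    rw [← hFF' (y fun i => (e' (x i)).1) x (hy _ hx.1) hx (by simp [y])]
    exact hFF' _ _ (hy _ hx.1) (hy' _ hx.1) (by simp [y, y']) π) hA
  set ζ := (∑ a, if Function.Injective a then ∑ π, H a π else 0)
        / ∑ a : Fin t → A, if Function.Injective a then (1 : ℂ) else 0
  have hn1 := hF _ (posSemidef_ite (posSemidef_haarMoment (o := o) (t := t)) (CollisionFree e))
  have hn2 := hF' _ (posSemidef_ite (posSemidef_haarMoment (o := o') (t := t)) (CollisionFree e'))
  have hb1 := hF _ (posSemidef_ite (posSemidef_haarMoment (o := o) (t := t))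
    fun x => ¬ CollisionFree e x)
  have hb2 := hF' _ (posSemidef_ite (posSemidef_haarMoment (o := o') (t := t))
    fun x => ¬ CollisionFree e' x)
  change ‖F (goodPart e o t)‖ ≤ (goodPart e o t).trace.re at hn1
  change ‖F' (goodPart e' o' t)‖ ≤ (goodPart e' o' t).trace.re at hn2
  change ‖F (badPart e o t)‖ ≤ (badPart e o t).trace.re at hb1
  change ‖F' (badPart e' o' t)‖ ≤ (badPart e' o' t).trace.re at hb2
  have hg0 := goodWeight_nonneg e o t
  have hg0' := goodWeight_nonneg e' o' t
  rw [trace_goodPart, h1, norm_mul, Complex.norm_of_nonneg hg0] at hn1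
  rw [trace_goodPart, h2, norm_mul, Complex.norm_of_nonneg hg0'] at hn2
  rw [trace_badPart] at hb1 hb2
  have hdiff : ‖F (goodPart e o t) - F' (goodPart e' o' t)‖
      ≤ |goodWeight e o t - goodWeight e' o' t| := by
    rw [h1, h2, ← sub_mul, norm_mul, ← Complex.ofReal_sub, Complex.norm_real, Real.norm_eq_abs]
    -- A positive weight on either side gives `‖ζ‖ ≤ 1`, by cancelling it in `hn1` or `hn2`; if both
    -- vanish, so does the difference.
    rcases hg0.eq_or_lt with h0 | h0
    · rcases hg0'.eq_or_lt with h0' | h0'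
      · simp [← h0, ← h0']
      · exact mul_le_of_le_one_right (abs_nonneg _) (by nlinarith)
    · exact mul_le_of_le_one_right (abs_nonneg _) (by nlinarith)
  have habs : |goodWeight e o t - goodWeight e' o' t|
      ≤ (1 - goodWeight e o t) + (1 - goodWeight e' o' t) := by
    rw [abs_le]
    constructor <;> linarith
  rw [haarMoment_eq_goodPart_add_badPart e o t, haarMoment_eq_goodPart_add_badPart e' o' t,
    map_add, map_add, add_sub_add_comm]
  have h3 := norm_add_le (F (goodPart e o t) - F' (goodPart e' o' t))
    (F (badPart e o t) - F' (badPart e' o' t))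
  have h4 := norm_sub_le (F (badPart e o t)) (F' (badPart e' o' t))
  linarith

end Compare

/-! ### Copies of a Haar random state -/

section HaarCopies

variable {W : Type} [Fintype W] [DecidableEq W]

/-- The column of a unitary that prepares the Haar random state. -/
def zeroColumn (U : Matrix.unitaryGroup (W → Bool) ℂ) : (W → Bool) → ℂ :=
  fun x => (U : Op W W) x fun _ => false

theorem continuous_zeroColumn :
    Continuous (zeroColumn : Matrix.unitaryGroup (W → Bool) ℂ → (W → Bool) → ℂ) :=
  continuous_pi fun x => continuous_unitary_entry x _

theorem integral_haarState {f : ((W → Bool) → ℂ) → ℂ} (hf : Continuous f) :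
    ∫ γ, f γ ∂haarState W = ∫ U, f (zeroColumn U) ∂haarUnitary (W → Bool) :=
  integral_map continuous_zeroColumn.measurable.aemeasurable hf.aestronglyMeasurable

theorem integrable_haarState {f : ((W → Bool) → ℂ) → ℂ} (hf : Continuous f) :
    Integrable f (haarState W) :=
  (integrable_map_measure hf.aestronglyMeasurable
    continuous_zeroColumn.measurable.aemeasurable).mpr
    (integrable_haarUnitary (hf.comp continuous_zeroColumn))

omit [Fintype W] [DecidableEq W] in
theorem continuous_tensorPower_pureState (t : ℕ) (x y : Fin t × W → Bool) :
    Continuous fun γ : (W → Bool) → ℂ => tensorPower t (pureState γ) x y :=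
  continuous_finsetProd _ fun _ _ => (continuous_apply _).mul (continuous_apply _).star

theorem haarCopies_eq_submatrix (t : ℕ) :
    haarCopies W t = (haarMoment (fun _ : W => false) t).submatrix
      (Equiv.curry (Fin t) W Bool) (Equiv.curry (Fin t) W Bool) := by
  ext x y
  exact integral_haarState (continuous_tensorPower_pureState t x y)

theorem isDensity_haarCopies (t : ℕ) : IsDensity (haarCopies W t) := by
  rw [haarCopies_eq_submatrix]
  refine ⟨posSemidef_haarMoment.submatrix _, ?_⟩
  rw [← trace_haarMoment (o := fun _ : W => false) (t := t)]
  exact Fintype.sum_equiv (Equiv.curry (Fin t) W Bool) _ _ fun x => rfl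

theorem conjBy_tensorPower {X : Type} (t : ℕ) (A : Op X W) (ρ : Op W W) :
    conjBy (tensorPower t A) (tensorPower t ρ) = tensorPower t (conjBy A ρ) := by
  rw [conjBy, conjTranspose_tensorPower, tensorPower_mul, tensorPower_mul, conjBy]

theorem conjBy_pureState {X : Type} (A : Op X W) (ψ : (W → Bool) → ℂ) :
    conjBy A (pureState ψ) = pureState (A *ᵥ ψ) := by
  rw [conjBy, pureState, Matrix.mul_vecMulVec, Matrix.vecMulVec_mul, pureState,
    Matrix.star_mulVec]

theorem conjBy_haarCopies {X : Type} [Fintype X] [DecidableEq X] (t : ℕ)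
    (A : Op (Fin t × X) (Fin t × W)) (x y : Fin t × X → Bool) :
    conjBy A (haarCopies W t) x y
      = ∫ γ, conjBy A (tensorPower t (pureState γ)) x y ∂haarState W :=
  linearMap_integral (Matrix.entryLinearMap ℂ ℂ x y ∘ₗ conjByₗ A)
    (fun γ => tensorPower t (pureState γ))
    fun x y => integrable_haarState (continuous_tensorPower_pureState t x y)

/-- Applying `U` to a Haar state left-multiplies the preparing unitary, so left invariance applies.
-/
theorem conjBy_unitary_haarCopies (t : ℕ) (U : Matrix.unitaryGroup (W → Bool) ℂ) :
    conjBy (tensorPower t (U : Op W W)) (haarCopies W t) = haarCopies W t := by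
  ext x y
  have hcont : Continuous fun γ : (W → Bool) → ℂ =>
      tensorPower t (pureState ((U : Op W W) *ᵥ γ)) x y :=
    (continuous_tensorPower_pureState t x y).comp (continuous_const.matrix_mulVec continuous_id)
  rw [conjBy_haarCopies]
  simp only [conjBy_tensorPower, conjBy_pureState]
  rw [integral_haarState hcont, haarCopies,
    integral_haarState (continuous_tensorPower_pureState t x y)]
  exact integral_unitary_mul U fun V => tensorPower t (pureState (zeroColumn V)) x y

theorem extendedCopies_eq {κ n m : ℕ} (t : ℕ)
    (V : (Fin κ → Bool) → Op (Fin (n + m)) (Fin n)) :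
    extendedCopies t V = ((2 : ℂ) ^ κ)⁻¹ • ∑ k : Fin κ → Bool,
      conjBy (tensorPower t (tensor (1 : Op (Fin n) (Fin n)) (V k)))
        (haarCopies (Fin n ⊕ Fin n) t) := by
  ext x y
  simp only [extendedCopies, Matrix.smul_apply, Matrix.sum_apply, conjBy_haarCopies, smul_eq_mul]

end HaarCopies

/-! ### Twirling the second register -/

section Twirl

variable {X Y : Type} [Fintype X] [DecidableEq X] [Fintype Y] [DecidableEq Y] {t : ℕ}

omit [DecidableEq X] in
theorem continuous_tensorPower_tensor_one (t : ℕ) :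
    Continuous fun U : Matrix.unitaryGroup (Y → Bool) ℂ =>
      tensorPower t (tensor (1 : Op X X) (U : Op Y Y)) :=
  continuous_pi fun _ => continuous_pi fun _ => continuous_finsetProd _ fun _ _ =>
    continuous_const.mul (continuous_unitary_entry _ _)

theorem continuous_linearMap_comp {Ω I J : Type*} [TopologicalSpace Ω] [Fintype I] [Fintype J]
    (f : Matrix I J ℂ →ₗ[ℂ] ℂ) {g : Ω → Matrix I J ℂ} (hg : Continuous g) :
    Continuous fun ω => f (g ω) :=
  f.continuous_of_finiteDimensional.comp hg

theorem continuous_twirl (f : Op (Fin t × (X ⊕ Y)) (Fin t × (X ⊕ Y)) →ₗ[ℂ] ℂ)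
    (ρ : Op (Fin t × (X ⊕ Y)) (Fin t × (X ⊕ Y))) :
    Continuous fun U : Matrix.unitaryGroup (Y → Bool) ℂ =>
      f (conjBy (tensorPower t (tensor (1 : Op X X) (U : Op Y Y))) ρ) :=
  continuous_linearMap_comp f
    (((continuous_tensorPower_tensor_one t).matrix_mul continuous_const).matrix_mul
      (continuous_tensorPower_tensor_one t).matrix_conjTranspose)

/-- A functional averaged over Haar random unitaries on the second register of each copy. -/
noncomputable def twirl (f : Op (Fin t × (X ⊕ Y)) (Fin t × (X ⊕ Y)) →ₗ[ℂ] ℂ) :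
    Op (Fin t × (X ⊕ Y)) (Fin t × (X ⊕ Y)) →ₗ[ℂ] ℂ where
  toFun ρ := ∫ U : Matrix.unitaryGroup (Y → Bool) ℂ,
    f (conjBy (tensorPower t (tensor (1 : Op X X) (U : Op Y Y))) ρ) ∂haarUnitary (Y → Bool)
  map_add' ρ σ := by
    rw [← integral_add (integrable_haarUnitary (continuous_twirl f ρ))
      (integrable_haarUnitary (continuous_twirl f σ))]
    refine integral_congr_ae (.of_forall fun U => ?_)
    change f (conjByₗ _ (ρ + σ)) = _
    rw [map_add, map_add]
    rfl
  map_smul' c ρ := by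
    rw [RingHom.id_apply, ← integral_smul]
    refine integral_congr_ae (.of_forall fun U => ?_)
    change f (conjByₗ _ (c • ρ)) = _
    rw [map_smul, map_smul]
    rfl

theorem unitary_isometry (U : Matrix.unitaryGroup (Y → Bool) ℂ) :
    (U : Op Y Y)ᴴ * (U : Op Y Y) = 1 := Matrix.UnitaryGroup.star_mul_self U

theorem norm_twirl_le (f : Op (Fin t × (X ⊕ Y)) (Fin t × (X ⊕ Y)) →ₗ[ℂ] ℂ)
    (hf : ∀ ρ : Op (Fin t × (X ⊕ Y)) (Fin t × (X ⊕ Y)), ρ.PosSemidef → ‖f ρ‖ ≤ ρ.trace.re)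
    {ρ : Op (Fin t × (X ⊕ Y)) (Fin t × (X ⊕ Y))} (hρ : ρ.PosSemidef) :
    ‖twirl f ρ‖ ≤ ρ.trace.re := by
  have h := norm_integral_le_of_norm_le_const (μ := haarUnitary (Y → Bool)) (C := ρ.trace.re)
    (f := fun U => f (conjBy (tensorPower t (tensor (1 : Op X X) (U : Op Y Y))) ρ))
    (.of_forall fun U => by
      refine (hf _ (posSemidef_conjBy _ hρ)).trans_eq ?_
      rw [trace_conjBy (isometry_tensorPower t (isometry_tensor_one (unitary_isometry U)))])
  rw [probReal_univ, mul_one] at h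
  exact h

theorem twirl_conjBy (f : Op (Fin t × (X ⊕ Y)) (Fin t × (X ⊕ Y)) →ₗ[ℂ] ℂ)
    (W : Matrix.unitaryGroup (Y → Bool) ℂ) (ρ : Op (Fin t × (X ⊕ Y)) (Fin t × (X ⊕ Y))) :
    twirl f (conjBy (tensorPower t (tensor (1 : Op X X) (W : Op Y Y))) ρ) = twirl f ρ := by
  refine Eq.trans ?_ (integral_mul_right_eq_self (μ := haarUnitary (Y → Bool))
    (fun U => f (conjBy (tensorPower t (tensor (1 : Op X X) (U : Op Y Y))) ρ)) W)
  refine integral_congr_ae (.of_forall fun U => ?_)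
  simp only [conjBy_conjBy, tensorPower_mul, tensor_mul, one_mul, Submonoid.coe_mul]

/-- The operators `1 ⊗ U` are unitaries on the whole register, which fix the Haar copies before any
averaging. -/
theorem twirl_haarCopies (f : Op (Fin t × (X ⊕ Y)) (Fin t × (X ⊕ Y)) →ₗ[ℂ] ℂ) :
    twirl f (haarCopies (X ⊕ Y) t) = f (haarCopies (X ⊕ Y) t) := by
  have h : ∀ U : Matrix.unitaryGroup (Y → Bool) ℂ,
      conjBy (tensorPower t (tensor (1 : Op X X) (U : Op Y Y))) (haarCopies (X ⊕ Y) t)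
        = haarCopies (X ⊕ Y) t := fun U =>
    conjBy_unitary_haarCopies t ⟨tensor (1 : Op X X) (U : Op Y Y),
      Matrix.mem_unitaryGroup_iff'.mpr (isometry_tensor_one (unitary_isometry U))⟩
  change ∫ U, _ ∂_ = _
  simp only [h, integral_const, probReal_univ, one_smul]

/-- Reindexing an operator by strings of copies. -/
def uncurryₗ (t : ℕ) (W : Type) :
    Matrix (Fin t → W → Bool) (Fin t → W → Bool) ℂ →ₗ[ℂ] Op (Fin t × W) (Fin t × W) where
  toFun M := M.submatrix (Equiv.curry (Fin t) W Bool) (Equiv.curry (Fin t) W Bool)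
  map_add' _ _ := rfl
  map_smul' _ _ := rfl

theorem uncurryₗ_single {W : Type} [Fintype W] [DecidableEq W] (x y : Fin t → W → Bool) :
    uncurryₗ t W (Matrix.single x y 1)
      = Matrix.single (fun p => x p.1 p.2) (fun p => y p.1 p.2) 1 :=
  Matrix.submatrix_single_equiv (Equiv.curry (Fin t) W Bool) (Equiv.curry (Fin t) W Bool) x y 1

/-- Applying an isometry that maps basis states to basis states, followed by a Haar random unitary,
to the second halves of the copies of a Haar random state gives nearly the copies of a Haar random
state on the larger register. -/
theorem norm_twirl_haarCopies_sub_le {Y' : Type} [Fintype Y'] [DecidableEq Y']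
    (g : (Y' → Bool) → Y → Bool) (hg : Function.Injective g)
    (f : Op (Fin t × (X ⊕ Y)) (Fin t × (X ⊕ Y)) →ₗ[ℂ] ℂ)
    (hf : ∀ ρ : Op (Fin t × (X ⊕ Y)) (Fin t × (X ⊕ Y)), ρ.PosSemidef → ‖f ρ‖ ≤ ρ.trace.re) :
    ‖twirl f (conjBy (tensorPower t (tensor (1 : Op X X) (basisMap g)))
        (haarCopies (X ⊕ Y') t)) - f (haarCopies (X ⊕ Y) t)‖
      ≤ 2 * ((t : ℝ) ^ 2 * (2 / 2 ^ Fintype.card X + 2 / 2 ^ Fintype.card Y')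
        + (t : ℝ) ^ 2 * (2 / 2 ^ Fintype.card X + 2 / 2 ^ Fintype.card Y)) := by
  let e := Equiv.sumArrowEquivProdArrow X Y' Bool
  let e' := Equiv.sumArrowEquivProdArrow X Y Bool
  let F := twirl f ∘ₗ conjByₗ (tensorPower t (tensor (1 : Op X X) (basisMap g)))
    ∘ₗ uncurryₗ t (X ⊕ Y')
  let F' := twirl f ∘ₗ uncurryₗ t (X ⊕ Y)
  have hF : ∀ M : Matrix (Fin t → X ⊕ Y' → Bool) (Fin t → X ⊕ Y' → Bool) ℂ, M.PosSemidef →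
      ‖F M‖ ≤ M.trace.re := by
    intro M hM
    refine (norm_twirl_le f hf (posSemidef_conjBy _ (hM.submatrix _))).trans_eq ?_
    rw [trace_conjBy (isometry_tensorPower t (isometry_tensor_one (basisMap_isometry hg)))]
    exact congrArg _ (Fintype.sum_equiv (Equiv.curry (Fin t) (X ⊕ Y') Bool) _ _ fun x => rfl)
  have hF' : ∀ M : Matrix (Fin t → X ⊕ Y → Bool) (Fin t → X ⊕ Y → Bool) ℂ, M.PosSemidef →
      ‖F' M‖ ≤ M.trace.re := by
    intro M hM
    refine (norm_twirl_le f hf (hM.submatrix _)).trans_eq ?_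
    exact congrArg _ (Fintype.sum_equiv (Equiv.curry (Fin t) (X ⊕ Y) Bool) _ _ fun x => rfl)
  have h := norm_map_haarMoment_sub_le e e' (fun _ => false) (fun _ => false) F F' hF hF' ?_
  · have h1 : F (haarMoment (fun _ => false) t)
        = twirl f (conjBy (tensorPower t (tensor (1 : Op X X) (basisMap g)))
          (haarCopies (X ⊕ Y') t)) := by
      rw [haarCopies_eq_submatrix]
      rfl
    have h2 : F' (haarMoment (fun _ => false) t) = f (haarCopies (X ⊕ Y) t) := by
      rw [← twirl_haarCopies, haarCopies_eq_submatrix]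
      rfl
    rw [h1, h2] at h
    have b1 := one_sub_goodWeight_le e (fun _ => false) t
    have b2 := one_sub_goodWeight_le e' (fun _ => false) t
    simp only [Fintype.card_fun, Fintype.card_bool, Nat.cast_pow, Nat.cast_ofNat] at b1 b2
    linarith
  · intro x x' hx hx' hxx' π
    -- Injectivity of `g` keeps the embedded second halves distinct, so a basis permutation of `Y`
    -- carries them to those of `x'`.
    obtain ⟨τ, hτ⟩ := exists_perm_comp_eq (hg.comp hx.2) hx'.2
    have key : ∀ σ : Fin t → Fin t,
        (fun p : Fin t × (X ⊕ Y) => Sum.elim (fun w => x (σ p.1) (Sum.inl w))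
          (τ (g fun w => x (σ p.1) (Sum.inr w))) p.2) = fun p => x' (σ p.1) p.2 := by
      intro σ
      funext ⟨i, w⟩
      rcases w with w | w
      · exact congrFun (congrFun hxx' (σ i)) w
      · exact congrFun (congrFun hτ (σ i)) w
    have k1 := key id
    have k2 := key π
    simp only [F, F', LinearMap.comp_apply, uncurryₗ_single]
    -- The twirl absorbs `τ`, after which both arguments are the same matrix unit; `k1` matches the
    -- row strings and `k2` the column strings.
    rw [← twirl_conjBy f (permUnitary τ)]
    congr 1
    change conjBy (tensorPower t (tensor 1 (basisMap τ))) (conjBy _ _) = _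
    rw [one_eq_basisMap, tensor_basisMap, tensor_basisMap, tensorPower_basisMap,
      tensorPower_basisMap, conjBy, conjBy, basisMap_conj_single, basisMap_conj_single]
    simp only [Sum.elim_inl, Sum.elim_inr, id] at k1 ⊢
    exact congrArg₂ (fun a b => Matrix.single a b (1 : ℂ)) k1 k2

end Twirl

/-! ### Rewiring a distinguisher of the two mixed states -/

section Rewire

/-- Move the first halves of the copies and the advice to one block of wires. -/
def rewire (t n a k : ℕ) :
    (Fin t × (Fin n ⊕ Fin k)) ⊕ Fin a ≃ Fin (t * n + a) ⊕ (Fin t × Fin k) :=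
  ((Equiv.prodSumDistrib _ _ _).sumCongr (Equiv.refl _)).trans <|
    (Equiv.sumAssoc _ _ _).trans <| ((Equiv.refl _).sumCongr (Equiv.sumComm _ _)).trans <|
    (Equiv.sumAssoc _ _ _).symm.trans <|
    ((finProdFinEquiv.sumCongr (Equiv.refl _)).trans finSumFinEquiv).sumCongr (Equiv.refl _)

theorem relabelOp_rewire {t n a N : ℕ} (V : Op (Fin N) (Fin n)) :
    relabelOp (rewire t n a N) (rewire t n a n)
      (tensor (tensorPower t (tensor (1 : Op (Fin n) (Fin n)) V)) (1 : Op (Fin a) (Fin a)))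
      = tensor 1 (tensorPower t V) := by
  ext x y
  simp only [relabelOp, Matrix.submatrix_apply, tensor, tensorPower, Finset.prod_mul_distrib,
    Matrix.one_apply, prod_ite_one_zero]
  rw [mul_right_comm, ite_zero_mul_ite_zero, one_mul]
  congr 1
  refine if_congr ?_ rfl rfl
  let e₀ : (Fin t × Fin n) ⊕ Fin a ≃ Fin (t * n + a) :=
    (finProdFinEquiv.sumCongr (Equiv.refl _)).trans finSumFinEquiv
  simp only [funext_iff]
  rw [← e₀.forall_congr_right, Sum.forall, Prod.forall]
  exact Iff.rfl

variable {G : GateSet}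

/-- Casts a distinguisher with advice in the shape demanded by PRI security: `q = t`, `ℓ = t n + a`,
and the advice becomes part of the input state. The size bounds hold in all cases so that these
choices form polynomial families. -/
theorem exists_rewired_circuit {t n N a : ℕ}
    (C : Circuit G ((Fin t × (Fin n ⊕ Fin N)) ⊕ Fin a) Unit) {α : Op (Fin a) (Fin a)}
    (hα : IsDensity α) {H : Op (Fin t × (Fin n ⊕ Fin n)) (Fin t × (Fin n ⊕ Fin n))}
    (hH : IsDensity H) :
    ∃ (q ℓ : ℕ) (C' : Circuit G (Fin ℓ ⊕ (Fin q × Fin N)) Unit),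
      q ≤ C.size ∧ ℓ ≤ C.size ∧ C'.size ≤ C.size + 1 ∧ ((1 ≤ n ∨ t = 0) →
        ∃ ρ : Op (Fin ℓ ⊕ (Fin q × Fin n)) (Fin ℓ ⊕ (Fin q × Fin n)), IsDensity ρ ∧
          ∀ V : Op (Fin N) (Fin n), C'.acceptₗ (conjBy (tensor 1 (tensorPower q V)) ρ)
            = C.acceptₗ (tensor
                (conjBy (tensorPower t (tensor (1 : Op (Fin n) (Fin n)) V)) H) α)) := by
  by_cases hn : 1 ≤ n ∨ t = 0
  · have hsize : t * (n + N) + a ≤ C.size := by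
      simp only [Circuit.size, Fintype.card_sum, Fintype.card_prod, Fintype.card_fin]
      omega
    have ht : t ≤ t * n := by
      rcases hn with h | h
      · exact Nat.le_mul_of_pos_right t h
      · simp [h]
    have htn : t * n ≤ t * (n + N) := Nat.mul_le_mul_left t (Nat.le_add_right n N)
    refine ⟨t, t * n + a, C.relabel (rewire t n a N), by omega, by omega, ?_, fun _ =>
      ⟨relabelOp (rewire t n a n) (rewire t n a n) (tensor H α), (hH.tensor hα).relabelOp _,
        fun V => ?_⟩⟩
    · rw [Circuit.size_relabel]
      omega
    · rw [← relabelOp_rewire, conjBy_relabelOp, Circuit.acceptₗ_relabel, tensor_conjBy, conjBy_one]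
  -- For `n = 0` and `t > 0` the wire count need not control `t`. A dummy circuit on one ancilla
  -- keeps the family polynomial; its size accounts for the `+ 1`.
  · refine ⟨0, 0, ⟨1, [], ⟨fun _ => Sum.inr 0, fun _ _ _ => rfl⟩⟩, by omega, by omega, ?_,
      fun h => absurd h hn⟩
    simp [Circuit.size]

end Rewire

/-! ### Main theorem -/

theorem PolyBounded.of_le {f g : ℕ → ℕ} (hg : PolyBounded g) (h : ∀ κ, f κ ≤ g κ + 1) :
    PolyBounded f := by
  obtain ⟨p, hp⟩ := hg
  refine ⟨p + 1, fun κ => ?_⟩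
  have := h κ
  have := hp κ
  simp only [Polynomial.eval_add, Polynomial.eval_one]
  omega

theorem append_left_injective {n m : ℕ} {α : Type*} (z : Fin m → α) :
    Function.Injective fun y : Fin n → α => Fin.append y z := by
  intro y y' h
  funext i
  have hi := congrFun h (Fin.castAdd m i)
  simpa only [Fin.append_left] using hi

theorem isometryOfUnitary_eq {n m : ℕ} (U : Matrix.unitaryGroup (Fin (n + m) → Bool) ℂ) :
    isometryOfUnitary U = (U : Op (Fin (n + m)) (Fin (n + m)))
      * basisMap fun y : Fin n → Bool => Fin.append y fun _ : Fin m => false := by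
  ext x y
  simp [isometryOfUnitary, Matrix.mul_apply, basisMap]

section Statistical

variable {n m t : ℕ}

/-- The statistical distance part: a Haar random isometry on one half of each copy. -/
theorem norm_integral_isometry_sub_le
    (f : Op (Fin t × (Fin n ⊕ Fin (n + m))) (Fin t × (Fin n ⊕ Fin (n + m))) →ₗ[ℂ] ℂ)
    (hf : ∀ ρ : Op (Fin t × (Fin n ⊕ Fin (n + m))) (Fin t × (Fin n ⊕ Fin (n + m))),
      ρ.PosSemidef → ‖f ρ‖ ≤ ρ.trace.re) :
    |(∫ U, (f (conjBy (tensorPower t (tensor (1 : Op (Fin n) (Fin n)) (isometryOfUnitary U)))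
        (haarCopies (Fin n ⊕ Fin n) t))).re ∂haarUnitary (Fin (n + m) → Bool))
      - (f (haarCopies (Fin n ⊕ Fin (n + m)) t)).re| ≤ 16 * ((t : ℝ) ^ 2 / 2 ^ n) := by
  let g : (Fin n → Bool) → Fin (n + m) → Bool := fun y => Fin.append y fun _ : Fin m => false
  have hg : Function.Injective g := append_left_injective _
  set ρ := conjBy (tensorPower t (tensor (1 : Op (Fin n) (Fin n)) (basisMap g)))
    (haarCopies (Fin n ⊕ Fin n) t) with hρ
  have h1 : ∀ U : Matrix.unitaryGroup (Fin (n + m) → Bool) ℂ,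
      conjBy (tensorPower t (tensor (1 : Op (Fin n) (Fin n)) (isometryOfUnitary U)))
        (haarCopies (Fin n ⊕ Fin n) t)
      = conjBy (tensorPower t (tensor (1 : Op (Fin n) (Fin n))
          (U : Op (Fin (n + m)) (Fin (n + m))))) ρ := by
    intro U
    rw [hρ, conjBy_conjBy, tensorPower_mul, tensor_mul, one_mul, isometryOfUnitary_eq]
  have h2 : ∫ U, (f (conjBy (tensorPower t (tensor (1 : Op (Fin n) (Fin n))
      (isometryOfUnitary U))) (haarCopies (Fin n ⊕ Fin n) t))).re
        ∂haarUnitary (Fin (n + m) → Bool) = (twirl f ρ).re := by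
    simp only [h1]
    exact integral_re (integrable_haarUnitary (continuous_twirl f ρ))
  rw [h2, ← Complex.sub_re]
  refine (Complex.abs_re_le_norm _).trans
    ((norm_twirl_haarCopies_sub_le g hg f hf).trans ?_)
  simp only [Fintype.card_fin]
  have hle : (2 : ℝ) / 2 ^ (n + m) ≤ 2 / 2 ^ n := by
    gcongr
    · norm_num
    · omega
  have ht := mul_le_mul_of_nonneg_left hle (sq_nonneg (t : ℝ))
  -- Four collision terms, each at most `t² · 2 / 2^n`, with the factor `2` from the comparison.
  have h16 : 16 * ((t : ℝ) ^ 2 / 2 ^ n) = 8 * ((t : ℝ) ^ 2 * (2 / 2 ^ n)) := by ring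
  rw [h16, mul_add, mul_add]
  linarith

end Statistical

theorem distinguisher_bound (G : GateSet) (n m t : ℕ → ℕ)
    (F : ∀ κ, Circuit G (Fin κ ⊕ Fin (n κ)) (Fin (n κ + m κ)))
    (V : ∀ κ, (Fin κ → Bool) → Op (Fin (n κ + m κ)) (Fin (n κ)))
    (hF : IsPRI G n m F V)
    (A : NonuniformDistinguisher G (fun κ => Fin (t κ) × (Fin (n κ) ⊕ Fin (n κ + m κ)))) :
    ∃ ε : ℕ → ℝ, Negligible ε ∧ ∀ κ : ℕ,
      |A.acceptProb κ (extendedCopies (t κ) (V κ))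
        - A.acceptProb κ (haarCopies (Fin (n κ) ⊕ Fin (n κ + m κ)) (t κ))|
      ≤ 16 * ((t κ : ℝ) ^ 2 / 2 ^ (n κ)) + ε κ := by
  have hH : ∀ κ, IsDensity (haarCopies (Fin (n κ) ⊕ Fin (n κ)) (t κ)) := fun κ =>
    isDensity_haarCopies _
  choose q ℓ C' hq hℓ hC' hρ using fun κ =>
    exists_rewired_circuit (A.circuit κ) (A.isDensity_advice κ) (hH κ)
  obtain ⟨ε, hε, hsec⟩ := hF.secure q ℓ (A.polySize.of_le fun κ => (hq κ).trans (Nat.le_succ _))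
    (A.polySize.of_le fun κ => (hℓ κ).trans (Nat.le_succ _)) ⟨C', A.polySize.of_le hC'⟩
  -- The absolute value makes the error nonnegative, as used in the case `n = 0` below.
  refine ⟨fun κ => |ε κ|, hε.trans_abs_le fun κ => (abs_abs (ε κ)).le, fun κ => ?_⟩
  let f : Op (Fin (t κ) × (Fin (n κ) ⊕ Fin (n κ + m κ)))
      (Fin (t κ) × (Fin (n κ) ⊕ Fin (n κ + m κ))) →ₗ[ℂ] ℂ :=
    (A.circuit κ).acceptₗ ∘ₗ tensorRight (A.advice κ)
  have hfA : ∀ ρ, A.acceptProb κ ρ = (f ρ).re := fun ρ => Circuit.acceptProb_eq _ _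
  have hf : ∀ ρ : Op (Fin (t κ) × (Fin (n κ) ⊕ Fin (n κ + m κ)))
      (Fin (t κ) × (Fin (n κ) ⊕ Fin (n κ + m κ))), ρ.PosSemidef → ‖f ρ‖ ≤ ρ.trace.re := by
    intro ρ hρ
    have h := (A.circuit κ).norm_acceptₗ_le (posSemidef_tensor hρ (A.isDensity_advice κ).1)
    rwa [trace_tensor, (A.isDensity_advice κ).2, mul_one] at h
  have hdens : ∀ ρ, IsDensity ρ → |(f ρ).re| ≤ 1 := fun ρ hd => by
    have h := (Complex.abs_re_le_norm _).trans (hf ρ hd.1)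
    rwa [hd.2, Complex.one_re] at h
  have hext : (f (extendedCopies (t κ) (V κ))).re = ((2 : ℝ) ^ κ)⁻¹ * ∑ k : Fin κ → Bool,
      (f (conjBy (tensorPower (t κ) (tensor (1 : Op (Fin (n κ)) (Fin (n κ))) (V κ k)))
        (haarCopies (Fin (n κ) ⊕ Fin (n κ)) (t κ)))).re := by
    have h2 : ((2 : ℂ) ^ κ)⁻¹ = (((2 : ℝ) ^ κ)⁻¹ : ℝ) := by push_cast; rfl
    rw [extendedCopies_eq, map_smul, map_sum, smul_eq_mul, h2, Complex.re_ofReal_mul,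
      Complex.re_sum]
  rw [hfA, hfA, hext]
  by_cases hn : 1 ≤ n κ ∨ t κ = 0
  · obtain ⟨ρ, hρd, hρV⟩ := hρ κ hn
    have h1 := hsec κ ρ hρd
    simp only [Circuit.acceptProb_eq, hρV] at h1
    have h2 := norm_integral_isometry_sub_le f hf
    have h3 := abs_sub_le
      (((2 : ℝ) ^ κ)⁻¹ * ∑ k : Fin κ → Bool,
        (f (conjBy (tensorPower (t κ) (tensor (1 : Op (Fin (n κ)) (Fin (n κ))) (V κ k)))
          (haarCopies (Fin (n κ) ⊕ Fin (n κ)) (t κ)))).re)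
      (∫ U, (f (conjBy (tensorPower (t κ) (tensor (1 : Op (Fin (n κ)) (Fin (n κ)))
        (isometryOfUnitary U))) (haarCopies (Fin (n κ) ⊕ Fin (n κ)) (t κ)))).re
        ∂haarUnitary (Fin (n κ + m κ) → Bool))
      (f (haarCopies (Fin (n κ) ⊕ Fin (n κ + m κ)) (t κ))).re
    have h4 := h1.trans (le_abs_self (ε κ))
    change |((2 : ℝ) ^ κ)⁻¹ * ∑ k : Fin κ → Bool,
        (f (conjBy (tensorPower (t κ) (tensor (1 : Op (Fin (n κ)) (Fin (n κ))) (V κ k)))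
          (haarCopies (Fin (n κ) ⊕ Fin (n κ)) (t κ)))).re
      - ∫ U, (f (conjBy (tensorPower (t κ) (tensor (1 : Op (Fin (n κ)) (Fin (n κ)))
        (isometryOfUnitary U))) (haarCopies (Fin (n κ) ⊕ Fin (n κ)) (t κ)))).re
        ∂haarUnitary (Fin (n κ + m κ) → Bool)| ≤ |ε κ| at h4
    linarith
  -- Here `n = 0` and `t ≥ 1`, so the bound is at least `16`, while two acceptance probabilities
  -- differ by at most `2`.
  · push Not at hn
    have hn0 : n κ = 0 := by omega
    have ht : (1 : ℝ) ≤ t κ := by exact_mod_cast Nat.one_le_iff_ne_zero.mpr hn.2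
    have havg : |((2 : ℝ) ^ κ)⁻¹ * ∑ k : Fin κ → Bool,
        (f (conjBy (tensorPower (t κ) (tensor (1 : Op (Fin (n κ)) (Fin (n κ))) (V κ k)))
          (haarCopies (Fin (n κ) ⊕ Fin (n κ)) (t κ)))).re| ≤ 1 := by
      rw [abs_mul, abs_of_pos (by positivity), inv_mul_le_iff₀ (by positivity), mul_one]
      refine (Finset.abs_sum_le_sum_abs _ _).trans ((Finset.sum_le_sum fun k _ => hdens _
        ((hH κ).conjBy (isometry_tensorPower _ (isometry_tensor_one (hF.isometry κ k))))).trans ?_)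
      simp
    have hhaar := hdens _ (isDensity_haarCopies (W := Fin (n κ) ⊕ Fin (n κ + m κ)) (t κ))
    have h2n : (2 : ℝ) ^ n κ = 1 := by rw [hn0, pow_zero]
    have ht2 : (1 : ℝ) ≤ (t κ : ℝ) ^ 2 := one_le_pow₀ ht
    refine (abs_sub _ _).trans ?_
    rw [h2n, div_one]
    linarith [abs_nonneg (ε κ)]

end Pseudorandom

theorem mainTheorem6 :
    ∃ C : ℝ, 0 < C ∧
      ∀ (G : Pseudorandom.GateSet) (n m t : ℕ → ℕ)
        (F : ∀ κ, Pseudorandom.Circuit G (Fin κ ⊕ Fin (n κ)) (Fin (n κ + m κ)))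
        (V : ∀ κ, (Fin κ → Bool) → Pseudorandom.Op (Fin (n κ + m κ)) (Fin (n κ))),
        Pseudorandom.IsPRI G n m F V →
        ∀ A : Pseudorandom.NonuniformDistinguisher G
            (fun κ => Fin (t κ) × (Fin (n κ) ⊕ Fin (n κ + m κ))),
          ∃ ε : ℕ → ℝ, Pseudorandom.Negligible ε ∧
            ∀ κ : ℕ,
              |A.acceptProb κ (Pseudorandom.extendedCopies (t κ) (V κ))
                - A.acceptProb κ
                    (Pseudorandom.haarCopies (Fin (n κ) ⊕ Fin (n κ + m κ)) (t κ))|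
              ≤ C * ((Nat.factorial (t κ) : ℝ) * (t κ : ℝ) ^ 2 / 2 ^ (n κ + m κ)
                    + (t κ : ℝ) ^ 2 / 2 ^ (n κ)) + ε κ := by
  refine ⟨16, by norm_num, fun G n m t F V hF A => ?_⟩
  obtain ⟨ε, hε, h⟩ := Pseudorandom.distinguisher_bound G n m t F V hF A
  refine ⟨ε, hε, fun κ => (h κ).trans ?_⟩
  -- The bound `16 t² / 2^n` suffices alone; the factorial term is nonnegative slack.
  have hpos : 0 ≤ (Nat.factorial (t κ) : ℝ) * (t κ : ℝ) ^ 2 / 2 ^ (n κ + m κ) := by positivity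
  linarith
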